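/- Consider the class of generalized Burgers equations \[\mathcal L_f:\quad u_t+uu_x+f(t,x)u_{xx}=0,\] where the arbitrary element $f$ runs through the smooth functions that are nowhere zero on an open subset of the $(t,x)$-plane. The framework is local. A point transformation is a smooth map $\varphi\colon \tilde t=T(t,x,u),\ \tilde x=X(t,x,u),\ \tilde u=U(t,x,u)$ on a domain (connected open set) of the $(t,x,u)$-space with nowhere vanishing Jacobian. It maps $\mathcal L_f$ to $\mathcal L_{\tilde f}$ if, over its domain, its second prolongation maps the hypersurface of the second-order jet space given by $\mathcal L_f$ into the one given by $\mathcal L_{\tilde f}$. The usual equivalence (pseudo)group $G^\sim$ of the class consists of the point transformations \[\tilde t=T(t,x,u),\quad \tilde x=X(t,x,u),\quad \tilde u=U(t,x,u),\quad \tilde f=\Phi(t,x,u,f)\] on domains of the $(t,x,u,f)$-space that map every equation of the class to an equation of the class. Theorem. The class is normalized in the usual sense: whenever a point transformation $\varphi$ maps an equation $\mathcal L_f$ of the class to an equation $\mathcal L_{\tilde f}$ of the class, there is $\mathcal T\in G^\sim$ whose restriction to the $(t,x,u)$-space is $\varphi$ and which takes $f$ to $\tilde f$ (over the domain of $\varphi$).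 The group $G^\sim$ consists exactly of the transformations (on domains where $\gamma t+\delta\ne0$) \[\tilde t=\frac{\alpha t+\beta}{\gamma t+\delta},\qquad \tilde x=\frac{\kappa x+\mu_1t+\mu_0}{\gamma t+\delta},\qquad \tilde u=\frac{\kappa(\gamma t+\delta)u-\kappa\gamma x+\mu_1\delta-\mu_0\gamma}{\alpha\delta-\beta\gamma},\qquad \tilde f=\frac{\kappa^2}{\alpha\delta-\beta\gamma}f,\] where $\alpha,\beta,\gamma,\delta,\mu_0,\mu_1,\kappa$ are arbitrary constants with $\alpha\delta-\beta\gamma\ne0$ and $\kappa\ne0$. The constants are defined up to a nonzero common multiplier: two tuples satisfying these constraints give the same transformation if and only if they are proportional. -/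

import Mathlib

open scoped ContDiff Topology

namespace GBE

/-- The space of the independent variables `(t, x)`. -/
abbrev Plane : Type := ℝ × ℝ

/-- The space of the variables `(t, x, u)`, written `((t, x), u)`. -/
abbrev Space : Type := Plane × ℝ

/-- The extended space of the variables `(t, x, u, f)`, written `(((t, x), u), f)`. -/
abbrev ExtSpace : Type := Space × ℝ

/-- The set of arbitrary elements: smooth functions `f(t, x)` that are defined and nowhere zero
on some open set of the plane. (Values outside `domain` are irrelevant.) -/
structure ArbitraryElement where
  domain : Set Plane
  isOpen_domain : IsOpen domain
  toFun : Plane → ℝ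
  smooth : ContDiffOn ℝ ∞ toFun domain
  ne_zero : ∀ z ∈ domain, toFun z ≠ 0

/-- The left-hand side `u_t + u u_x + f u_xx` of the equation, evaluated at the point `z`. -/
noncomputable def lhs (f u : Plane → ℝ) (z : Plane) : ℝ :=
  deriv (fun t => u (t, z.2)) z.1 + u z * deriv (fun x => u (z.1, x)) z.2
    + f z * iteratedDeriv 2 (fun x => u (z.1, x)) z.2

/-- A (local) point transformation in the space of `(t, x, u)` with domain `Ω`: smooth,
with nowhere vanishing Jacobian determinant. -/
def IsPointTransformation (Ω : Set Space) (φ : Space → Space) : Prop :=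
  IsOpen Ω ∧ IsConnected Ω ∧ ContDiffOn ℝ ∞ φ Ω ∧ ∀ p ∈ Ω, (fderiv ℝ φ p).det ≠ 0

/-- Near the point over `z`, the map `φ` sends the graph of `u` into the graph of `v`:
`v (T, X) = U` along the graph of `u`, where `φ = ((T, X), U)`. -/
def TransformsNear (φ : Space → Space) (u v : Plane → ℝ) (z : Plane) : Prop :=
  ∀ᶠ y in 𝓝 z, v (φ (y, u y)).1 = (φ (y, u y)).2

/-- On `Ω`, the map `φ` sends the equation of `f` to the equation of `g`. The equations are
regarded as hypersurfaces of the second-order jet space, and the second prolongation of `φ` has to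
map the first of them, over `Ω`, into the second one. The prolongation is expressed in the usual
way through representatives of jets: it takes the 2-jet of `u` at `p.1` to the 2-jet at `(φ p).1`
of the function `v` whose graph is the image of the graph of `u`. -/
def MapsEquation (Ω : Set Space) (φ : Space → Space) (f g : ArbitraryElement) : Prop :=
  ∀ p ∈ Ω, p.1 ∈ f.domain ∧ (φ p).1 ∈ g.domain ∧
    ∀ u v : Plane → ℝ, ContDiffAt ℝ ∞ u p.1 → ContDiffAt ℝ ∞ v (φ p).1 →
      u p.1 = p.2 → TransformsNear φ u v p.1 →
      lhs f.toFun u p.1 = 0 → lhs g.toFun v (φ p).1 = 0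

/-- `(f, φ, g)` is an admissible transformation of the class, where `φ` has the domain `Ω`. -/
def IsAdmissible (Ω : Set Space) (f : ArbitraryElement) (φ : Space → Space)
    (g : ArbitraryElement) : Prop :=
  IsPointTransformation Ω φ ∧ MapsEquation Ω φ f g

/-- The transformation of the extended space with the components `((T, X), U) = φ`, which do not
involve `f` (projectability to the space of `(t, x, u)`), and `Φ`, which may depend on all of
`t`, `x`, `u`, `f`. -/
def extend (φ : Space → Space) (Φ : ExtSpace → ℝ) (p : ExtSpace) : ExtSpace :=
  (φ p.1, Φ p)

/-- The points `(t, x, u)` at which `f` is defined and `(t, x, u, f(t, x))` belongs to `O`. -/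
def slice (O : Set ExtSpace) (f : ArbitraryElement) : Set Space :=
  {p | p.1 ∈ f.domain ∧ (p, f.toFun p.1) ∈ O}

/-- On the domain `O`, the transformation with components `φ`, `Φ` takes the function `f` to the
function `g`: `g (T, X) = Φ (t, x, u, f (t, x))`. -/
def TransformsElement (O : Set ExtSpace) (φ : Space → Space) (Φ : ExtSpace → ℝ)
    (f g : ArbitraryElement) : Prop :=
  ∀ p ∈ slice O f, (φ p).1 ∈ g.domain ∧ g.toFun (φ p).1 = Φ (p, f.toFun p.1)

/-- The transformation with components `φ`, `Φ` and domain `O` belongs to the usual equivalence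
(pseudo)group of the class: it is a point transformation of the extended space, projectable to the
space of `(t, x, u)`, which maps every equation of the class to an equation of the class. -/
def IsEquivalence (O : Set ExtSpace) (φ : Space → Space) (Φ : ExtSpace → ℝ) : Prop :=
  IsOpen O ∧ IsConnected O ∧ ContDiffOn ℝ ∞ (extend φ Φ) O ∧
    (∀ p ∈ O, (fderiv ℝ (extend φ Φ) p).det ≠ 0) ∧
    ∀ f : ArbitraryElement, ∃ g : ArbitraryElement,
      TransformsElement O φ Φ f g ∧ MapsEquation (slice O f) φ f g

/-- The class is normalized in the usual sense: every admissible transformation is induced by an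
element of the usual equivalence group. -/
def IsNormalized : Prop :=
  ∀ (Ω : Set Space) (f : ArbitraryElement) (φ : Space → Space) (g : ArbitraryElement),
    IsAdmissible Ω f φ g →
      ∃ (O : Set ExtSpace) (ψ : Space → Space) (Ψ : ExtSpace → ℝ),
        IsEquivalence O ψ Ψ ∧ Prod.fst '' O = Ω ∧ Set.EqOn ψ φ Ω ∧
          Ω ⊆ slice O f ∧ TransformsElement O ψ Ψ f g

/-- Tuples of constants `α, β, γ, δ, κ, μ₀, μ₁`. -/
@[ext]
structure Params where
  α : ℝ
  β : ℝ
  γ : ℝ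
  δ : ℝ
  κ : ℝ
  μ₀ : ℝ
  μ₁ : ℝ

/-- The expression `αδ - βγ`. -/
def Params.disc (c : Params) : ℝ := c.α * c.δ - c.β * c.γ

/-- The constraints `αδ - βγ ≠ 0`, `κ ≠ 0`. -/
def Params.Nondegenerate (c : Params) : Prop := c.disc ≠ 0 ∧ c.κ ≠ 0

/-- Multiplication of all the constants by the same number. -/
def Params.scale (s : ℝ) (c : Params) : Params :=
  ⟨s * c.α, s * c.β, s * c.γ, s * c.δ, s * c.κ, s * c.μ₀, s * c.μ₁⟩

/-- On `O`, the transformation with components `φ`, `Φ` is given by the linear-fractional formulas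
with the constants `c` (whose denominators do not vanish on `O`). -/
def HasForm (c : Params) (O : Set ExtSpace) (φ : Space → Space) (Φ : ExtSpace → ℝ) : Prop :=
  ∀ t x u w : ℝ, (((t, x), u), w) ∈ O →
    c.γ * t + c.δ ≠ 0 ∧
    φ ((t, x), u) =
      (((c.α * t + c.β) / (c.γ * t + c.δ), (c.κ * x + c.μ₁ * t + c.μ₀) / (c.γ * t + c.δ)),
        (c.κ * (c.γ * t + c.δ) * u - c.κ * c.γ * x + c.μ₁ * c.δ - c.μ₀ * c.γ) / c.disc) ∧
    Φ (((t, x), u), w) = c.κ ^ 2 / c.disc * w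

end GBE

/-! A transformation (T, X, U) is tested on quadratic polynomials with prescribed 2-jets. The jets
lying on the equation of f leave u_x, u_xx and u_tt free, so the mapping condition splits into
identities in these variables (`jet_relations`, `Setting.jet_equation`). Freedom of u_tt forces T_x
= T_u = 0. The coefficient of u_xx gives T_t g = f (X_x + u_x X_u)^2, whose left side does not
contain u_x, hence X_u = 0. The powers of u_x give three further equations that still contain f.
Since f does not depend on u, differentiating them with respect to u, and then the consequences with
respect to x, removes f altogether: U_uu = U_xu = U_xx = X_xx = 0, T_t U_u = X_x, T_t U = X_t + u
X_x and U_t + u U_x = 0.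

This system (`Determining`) is the same for every equation of the class, and that is the source of
normalization. On a connected domain it integrates completely (`Determining.exists_params`): U_x is
constant, U_u is an affine function L of t, and L^2 T_t is constant, which makes T, X, U
linear-fractional and g = (κ^2 / (αδ - βγ)) f. Conversely, such a transformation multiplies the
left-hand side of the equation by a nonvanishing function of t (`transforms_lhs`), so it acts on the
whole class, and every admissible transformation extends to an equivalence transformation.

For an element of the equivalence group, constant values of f already suffice: the corresponding
slices cover the projection of the domain, and they determine the f-component where f ≠ 0, while
continuity settles f = 0. Uniqueness of the constants up to scaling is a comparison of coefficients
on a small ball. -/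

namespace GBE

/-! ### Directional derivatives and chain rules along curves -/

/-- The directional derivative of a function on the space of `(t, x, u)`. -/
noncomputable def pd (v : Space) (F : Space → ℝ) (p : Space) : ℝ := fderiv ℝ F p v

/-- The coordinate vector of `t`. -/
def et : Space := ((1, 0), 0)

/-- The coordinate vector of `x`. -/
def ex : Space := ((0, 1), 0)

/-- The coordinate vector of `u`. -/
def eu : Space := ((0, 0), 1)

theorem pd_comb (F : Space → ℝ) (p : Space) (a b c : ℝ) :
    pd ((a, b), c) F p = a * pd et F p + b * pd ex F p + c * pd eu F p := by
  have : (((a, b), c) : Space) = a • et + b • ex + c • eu := by simp [et, ex, eu]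
  simp only [pd, this, map_add, map_smul, smul_eq_mul]

theorem contDiffAt_fderiv_apply {E : Type*} [NormedAddCommGroup E] [NormedSpace ℝ E]
    {F : E → ℝ} {p : E} (h : ContDiffAt ℝ ∞ F p) (v : E) :
    ContDiffAt ℝ ∞ (fun y => fderiv ℝ F y v) p :=
  (h.fderiv_right (m := ∞) (by simp)).clm_apply contDiffAt_const

theorem contDiffAt_pd {F : Space → ℝ} {p : Space} (h : ContDiffAt ℝ ∞ F p) (v : Space) :
    ContDiffAt ℝ ∞ (pd v F) p := contDiffAt_fderiv_apply h v

theorem differentiableAt_of_smooth {E G : Type*} [NormedAddCommGroup E] [NormedSpace ℝ E]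
    [NormedAddCommGroup G] [NormedSpace ℝ G] {F : E → G} {p : E} (h : ContDiffAt ℝ ∞ F p) : DifferentiableAt ℝ F p :=
  h.differentiableAt (by simp)

theorem eventually_differentiableAt {E : Type*} [NormedAddCommGroup E] [NormedSpace ℝ E]
    {F : E → ℝ} {p : E} (h : ContDiffAt ℝ ∞ F p) : ∀ᶠ y in 𝓝 p, DifferentiableAt ℝ F y := by
  have h1 : ContDiffAt ℝ 1 F p := h.of_le (by simp)
  filter_upwards [h1.eventually (by simp)] with y hy using hy.differentiableAt (by simp)

/-- The left-hand side of the equation in terms of Fréchet derivatives. -/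
theorem lhs_eq {f v : Plane → ℝ} {z : Plane} (h : ContDiffAt ℝ ∞ v z) :
    lhs f v z = fderiv ℝ v z (1, 0) + v z * fderiv ℝ v z (0, 1)
      + f z * fderiv ℝ (fun y => fderiv ℝ v y (0, 1)) z (0, 1) := by
  have hx : ∀ (w : Plane → ℝ) (x : ℝ), DifferentiableAt ℝ w (z.1, x) →
      HasDerivAt (fun x => w (z.1, x)) (fderiv ℝ w (z.1, x) (0, 1)) x := by
    intro w x hw
    exact hw.hasFDerivAt.comp_hasDerivAt x ((hasDerivAt_const x z.1).prodMk (hasDerivAt_id x))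
  have ht : HasDerivAt (fun t => v (t, z.2)) (fderiv ℝ v z (1, 0)) z.1 :=
    HasFDerivAt.comp_hasDerivAt (f := fun t : ℝ => (t, z.2)) z.1
      (differentiableAt_of_smooth h).hasFDerivAt
      ((hasDerivAt_id z.1).prodMk (hasDerivAt_const z.1 z.2))
  have hc : Filter.Tendsto (fun x : ℝ => (z.1, x)) (𝓝 z.2) (𝓝 z) := by
    have : Continuous (fun x : ℝ => (z.1, x)) := by fun_prop
    exact this.tendsto z.2
  have he : deriv (fun x => v (z.1, x)) =ᶠ[𝓝 z.2] fun x => fderiv ℝ v (z.1, x) (0, 1) := by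
    filter_upwards [hc.eventually (eventually_differentiableAt h)] with x hh
    exact (hx v x hh).deriv
  rw [lhs, ht.deriv, he.eq_of_nhds, iteratedDeriv_succ, iteratedDeriv_one, he.deriv_eq,
    (hx _ z.2 (differentiableAt_of_smooth (contDiffAt_fderiv_apply h (0, 1)))).deriv]

/-- The curve is the lift of a straight line of the (t, x)-plane to the graph of a quadratic
function with slope m and second derivative h along that line. -/
theorem hasDerivAt_graph_line (p : Space) (a b m h s : ℝ) :
    HasDerivAt (fun s : ℝ => (((p.1.1 + s * a, p.1.2 + s * b), p.2 + s * m + s ^ 2 / 2 * h) : Space))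
      ((a, b), m + s * h) s := by
  refine HasDerivAt.prodMk (HasDerivAt.prodMk ?_ ?_) ?_
  · simpa using ((hasDerivAt_id s).mul_const a).const_add p.1.1
  · simpa using ((hasDerivAt_id s).mul_const b).const_add p.1.2
  · have := (((hasDerivAt_id s).mul_const m).const_add p.2).add
      ((((hasDerivAt_id s).pow 2).div_const 2).mul_const h)
    refine this.congr_deriv ?_
    simp

theorem continuous_graph_line (p : Space) (a b m h : ℝ) :
    Filter.Tendsto (fun s : ℝ => (((p.1.1 + s * a, p.1.2 + s * b), p.2 + s * m + s ^ 2 / 2 * h) : Space))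
      (𝓝 0) (𝓝 p) := by
  have := (hasDerivAt_graph_line p a b m h 0).continuousAt.tendsto
  simpa using this

/-- First and second derivatives of a smooth function along a quadratic curve. -/
theorem curve_derivs {F : Space → ℝ} {p : Space} (hF : ContDiffAt ℝ ∞ F p) (a b m h : ℝ) :
    ∃ D : ℝ → ℝ,
      (∀ᶠ s in 𝓝 (0 : ℝ), HasDerivAt
        (fun s : ℝ => F ((p.1.1 + s * a, p.1.2 + s * b), p.2 + s * m + s ^ 2 / 2 * h)) (D s) s) ∧
      D 0 = pd ((a, b), m) F p ∧
      HasDerivAt D (pd ((a, b), m) (pd ((a, b), m) F) p + h * pd eu F p) 0 := by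
  have hc := continuous_graph_line p a b m h
  have h0 : ∀ G : Space → ℝ, DifferentiableAt ℝ G p → HasDerivAt
      (fun s : ℝ => G ((p.1.1 + s * a, p.1.2 + s * b), p.2 + s * m + s ^ 2 / 2 * h))
      (pd ((a, b), m) G p) 0 := by
    intro G hG
    have hg := hasDerivAt_graph_line p a b m h 0
    have h1 : HasFDerivAt G (fderiv ℝ G p)
      ((fun s : ℝ => (((p.1.1 + s * a, p.1.2 + s * b), p.2 + s * m + s ^ 2 / 2 * h) : Space)) 0) := by
      simpa using hG.hasFDerivAt
    refine (h1.comp_hasDerivAt (0 : ℝ) hg).congr_deriv ?_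
    simp [pd]
  refine ⟨fun s => pd ((a, b), m) F
      ((p.1.1 + s * a, p.1.2 + s * b), p.2 + s * m + s ^ 2 / 2 * h) + s * h * pd eu F
      ((p.1.1 + s * a, p.1.2 + s * b), p.2 + s * m + s ^ 2 / 2 * h), ?_, ?_, ?_⟩
  · filter_upwards [hc.eventually (eventually_differentiableAt hF)] with s hs
    have := hs.hasFDerivAt.comp_hasDerivAt s (hasDerivAt_graph_line p a b m h s)
    refine this.congr_deriv ?_
    have e := pd_comb F ((p.1.1 + s * a, p.1.2 + s * b), p.2 + s * m + s ^ 2 / 2 * h) a b (m + s * h)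
    rw [pd_comb _ _ a b m]
    rw [pd] at e
    rw [e]; ring
  · simp
  · have h1 := h0 _ (differentiableAt_of_smooth (contDiffAt_pd hF ((a, b), m)))
    have h2 := h0 _ (differentiableAt_of_smooth (contDiffAt_pd hF eu))
    have := h1.add (((hasDerivAt_id (0 : ℝ)).mul_const h).mul h2)
    refine this.congr_deriv ?_
    simp

/-- Second-order chain rule along a curve of the plane. -/
theorem second_chain {v : Plane → ℝ} {P Q : ℝ → ℝ} {P' Q' : ℝ → ℝ} {P'' Q'' : ℝ}
    (hv : ContDiffAt ℝ ∞ v (P 0, Q 0))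
    (hP : ∀ᶠ s in 𝓝 (0 : ℝ), HasDerivAt P (P' s) s) (hP' : HasDerivAt P' P'' 0)
    (hQ : ∀ᶠ s in 𝓝 (0 : ℝ), HasDerivAt Q (Q' s) s) (hQ' : HasDerivAt Q' Q'' 0)
    {R R' : ℝ → ℝ} {R'' : ℝ}
    (hR : ∀ᶠ s in 𝓝 (0 : ℝ), HasDerivAt R (R' s) s) (hR' : HasDerivAt R' R'' 0)
    (h : ∀ᶠ s in 𝓝 (0 : ℝ), v (P s, Q s) = R s) :
    P' 0 * fderiv ℝ v (P 0, Q 0) (1, 0) + Q' 0 * fderiv ℝ v (P 0, Q 0) (0, 1) = R' 0 ∧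
    (P' 0 = 0 → Q' 0 ^ 2 * fderiv ℝ (fun y => fderiv ℝ v y (0, 1)) (P 0, Q 0) (0, 1)
      + P'' * fderiv ℝ v (P 0, Q 0) (1, 0) + Q'' * fderiv ℝ v (P 0, Q 0) (0, 1) = R'') := by
  have hPQ : HasDerivAt (fun s => (P s, Q s)) (P' 0, Q' 0) 0 :=
    hP.self_of_nhds.prodMk hQ.self_of_nhds
  have hcomb : ∀ (w : Plane → ℝ) (y : Plane) (a b : ℝ),
      fderiv ℝ w y (a, b) = a * fderiv ℝ w y (1, 0) + b * fderiv ℝ w y (0, 1) := by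
    intro w y a b
    have : ((a, b) : Plane) = a • ((1, 0) : Plane) + b • ((0, 1) : Plane) := by simp
    rw [this, map_add, map_smul, map_smul, smul_eq_mul, smul_eq_mul]
  have hev : ∀ᶠ s in 𝓝 (0 : ℝ), P' s * fderiv ℝ v (P s, Q s) (1, 0)
      + Q' s * fderiv ℝ v (P s, Q s) (0, 1) = R' s := by
    filter_upwards [hP, hQ, hR, h.eventually_nhds,
      hPQ.continuousAt.tendsto.eventually (eventually_differentiableAt hv)] with s h1 h2 h3 h4 h5
    have h6 := h5.hasFDerivAt.comp_hasDerivAt s (h1.prodMk h2)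
    rw [hcomb] at h6
    exact h6.unique (h3.congr_of_eventuallyEq h4)
  refine ⟨hev.self_of_nhds, fun h0 => ?_⟩
  have hd : ∀ w : Plane, HasDerivAt (fun s => fderiv ℝ v (P s, Q s) w)
      (fderiv ℝ (fun y => fderiv ℝ v y w) (P 0, Q 0) (P' 0, Q' 0)) 0 := by
    intro w
    exact (differentiableAt_of_smooth
      (contDiffAt_fderiv_apply hv w)).hasFDerivAt.comp_hasDerivAt (0 : ℝ) hPQ
  -- Differentiating the first-order identity at 0; as P' 0 = 0, the terms with v_TT and v_TX
  -- disappear and only v_XX survives.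
  have h7 := (hP'.mul (hd (1, 0))).add (hQ'.mul (hd (0, 1)))
  have h8 := h7.unique (hR'.congr_of_eventuallyEq hev)
  rw [← h8, h0, hcomb _ _ 0 (Q' 0), hcomb _ _ 0 (Q' 0)]
  ring

/-! ### Polynomial representatives of jets and their prolongation -/

/-- The quadratic polynomial with the value `p.2` at `p.1`, the first derivatives `a`, `b`, the pure
second derivatives `s`, `r` and zero mixed derivative. -/
noncomputable def quad (p : Space) (a b r s : ℝ) (y : Plane) : ℝ :=
  p.2 + a * (y.1 - p.1.1) + b * (y.2 - p.1.2) + r / 2 * (y.2 - p.1.2) ^ 2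
    + s / 2 * (y.1 - p.1.1) ^ 2

theorem contDiff_quad (p : Space) (a b r s : ℝ) : ContDiff ℝ ∞ (quad p a b r s) := by
  unfold quad; fun_prop

theorem quad_self (p : Space) (a b r s : ℝ) : quad p a b r s p.1 = p.2 := by
  simp [quad]

theorem hasDerivAt_quadratic (c0 a b x0 x : ℝ) :
    HasDerivAt (fun x => c0 + a * (x - x0) + b / 2 * (x - x0) ^ 2) (a + b * (x - x0)) x := by
  have h := (hasDerivAt_id x).sub_const x0
  refine (((h.const_mul a).const_add c0).add ((h.pow 2).const_mul (b / 2))).congr_deriv ?_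
  simp; ring

theorem lhs_quad (f : Plane → ℝ) (p : Space) (a b r s : ℝ) :
    lhs f (quad p a b r s) p.1 = a + p.2 * b + f p.1 * r := by
  have e1 : (fun x => quad p a b r s (p.1.1, x)) =
      fun x => p.2 + b * (x - p.1.2) + r / 2 * (x - p.1.2) ^ 2 := by
    funext x; simp [quad]
  have e2 : (fun t => quad p a b r s (t, p.1.2)) =
      fun t => p.2 + a * (t - p.1.1) + s / 2 * (t - p.1.1) ^ 2 := by
    funext x; simp [quad]
  have e3 : deriv (fun x => p.2 + b * (x - p.1.2) + r / 2 * (x - p.1.2) ^ 2) =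
      fun x => b + r * (x - p.1.2) := by
    funext x; exact (hasDerivAt_quadratic _ _ _ _ _).deriv
  have e4 : HasDerivAt (fun x => b + r * (x - p.1.2)) r p.1.2 := by
    simpa using (((hasDerivAt_id p.1.2).sub_const p.1.2).const_mul r).const_add b
  rw [lhs, e1, e2, iteratedDeriv_succ, iteratedDeriv_one, e3, e4.deriv,
    (hasDerivAt_quadratic _ _ _ _ _).deriv, quad_self]
  simp

/-- A map that is an immersion on the graph of `u` transversally to the fibres transforms `u` into
a smooth function. -/
theorem exists_transform {φ : Space → Space} {p : Space} (hφ : ContDiffAt ℝ ∞ φ p)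
    {u : Plane → ℝ} (hu : ContDiffAt ℝ ∞ u p.1) (hup : u p.1 = p.2)
    (hinj : ∀ η : Plane, (fderiv ℝ φ p (η, fderiv ℝ u p.1 η)).1 = 0 → η = 0) :
    ∃ v : Plane → ℝ, ContDiffAt ℝ ∞ v (φ p).1 ∧ TransformsNear φ u v p.1 := by
  have hg : ContDiffAt ℝ ∞ (fun y : Plane => φ (y, u y)) p.1 := by
    have h1 : ContDiffAt ℝ ∞ (fun y : Plane => (y, u y)) p.1 := contDiffAt_id.prodMk hu
    have h2 : ContDiffAt ℝ ∞ φ ((fun y : Plane => (y, u y)) p.1) := by simpa [hup] using hφ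
    exact h2.comp p.1 h1
  have ha : ContDiffAt ℝ ∞ (fun y : Plane => (φ (y, u y)).1) p.1 := hg.fst
  have hb : ContDiffAt ℝ ∞ (fun y : Plane => (φ (y, u y)).2) p.1 := hg.snd
  set A := fderiv ℝ (fun y : Plane => (φ (y, u y)).1) p.1 with hA
  have hAe : ∀ η, A η = (fderiv ℝ φ p (η, fderiv ℝ u p.1 η)).1 := by
    intro η
    have h1 : HasFDerivAt (fun y : Plane => (y, u y))
        ((ContinuousLinearMap.id ℝ Plane).prod (fderiv ℝ u p.1)) p.1 :=
      (hasFDerivAt_id p.1).prodMk (differentiableAt_of_smooth hu).hasFDerivAt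
    have h2 : HasFDerivAt φ (fderiv ℝ φ p) ((fun y : Plane => (y, u y)) p.1) := by
      simpa [hup] using (differentiableAt_of_smooth hφ).hasFDerivAt
    have h3 : HasFDerivAt (fun y : Plane => (φ (y, u y)).1) _ p.1 := (h2.comp p.1 h1).fst
    rw [hA, h3.fderiv]
    rfl
  have hAinj : Function.Injective A := by
    refine (injective_iff_map_eq_zero A).2 fun η h => hinj η ?_
    rw [← hAe, h]
  -- An injective endomorphism of the plane is invertible, so the inverse function theorem applies
  -- to y ↦ (T, X)(y, u y); then v is U on the graph composed with the local inverse.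
  let e : Plane ≃L[ℝ] Plane :=
    (LinearEquiv.ofInjectiveEndo A.toLinearMap hAinj).toContinuousLinearEquiv
  have hA' : HasFDerivAt (fun y : Plane => (φ (y, u y)).1) (e : Plane →L[ℝ] Plane) p.1 := by
    refine (differentiableAt_of_smooth ha).hasFDerivAt.congr_fderiv ?_
    ext1 <;> rfl
  have hst : HasStrictFDerivAt (fun y : Plane => (φ (y, u y)).1) (e : Plane →L[ℝ] Plane) p.1 :=
    ha.hasStrictFDerivAt' hA' (by simp)
  have hap : (fun y : Plane => (φ (y, u y)).1) p.1 = (φ p).1 := by simp [hup]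
  have hinvp : hst.localInverse _ e p.1 (φ p).1 = p.1 := by
    rw [← hap]; exact hst.localInverse_apply_image
  have hinv : ContDiffAt ℝ ∞ (hst.localInverse _ e p.1) (φ p).1 := by
    rw [← hap]
    exact ha.to_localInverse hA' (by simp)
  refine ⟨fun y => (φ (hst.localInverse _ e p.1 y, u (hst.localInverse _ e p.1 y))).2, ?_, ?_⟩
  · have h4 : ContDiffAt ℝ ∞ (fun y : Plane => (φ (y, u y)).2)
        (hst.localInverse _ e p.1 (φ p).1) := by rwa [hinvp]
    exact h4.comp _ hinv
  · filter_upwards [hst.eventually_left_inverse] with y hy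
    simp only [hy]

/-- The consequences for the derivatives of `φ` at `p` of the fact that `φ` maps the equation of `f`
to the equation of `g`, for the jet at `p` of the function `quad p a b r s`; the numbers `A`, `B`,
`C` are the derivatives `v_T`, `v_X`, `v_XX` of the transformed function. -/
theorem jet_relations {Ω : Set Space} {φ : Space → Space} {f g : ArbitraryElement}
    (hΩ : IsOpen Ω) (hφ : ContDiffOn ℝ ∞ φ Ω) (hm : MapsEquation Ω φ f g)
    {T X U : Space → ℝ} (hT : T = fun p => (φ p).1.1) (hX : X = fun p => (φ p).1.2)
    (hU : U = fun p => (φ p).2)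
    {p : Space} (hp : p ∈ Ω) {a b r s : ℝ} (hlhs : a + p.2 * b + f.toFun p.1 * r = 0)
    (hΔ : pd ((1, 0), a) T p * pd ((0, 1), b) X p - pd ((0, 1), b) T p * pd ((1, 0), a) X p ≠ 0) :
    ∃ A B C : ℝ,
      (∀ ξ₁ ξ₂ : ℝ, pd ((ξ₁, ξ₂), a * ξ₁ + b * ξ₂) T p * A + pd ((ξ₁, ξ₂), a * ξ₁ + b * ξ₂) X p * B
        = pd ((ξ₁, ξ₂), a * ξ₁ + b * ξ₂) U p) ∧
      (∀ ξ₁ ξ₂ : ℝ, ∀ ξ : Space, ξ = ((ξ₁, ξ₂), a * ξ₁ + b * ξ₂) → pd ξ T p = 0 →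
        pd ξ X p ^ 2 * C
          + (pd ξ (pd ξ T) p + (s * ξ₁ ^ 2 + r * ξ₂ ^ 2) * pd eu T p) * A
          + (pd ξ (pd ξ X) p + (s * ξ₁ ^ 2 + r * ξ₂ ^ 2) * pd eu X p) * B
          = pd ξ (pd ξ U) p + (s * ξ₁ ^ 2 + r * ξ₂ ^ 2) * pd eu U p) ∧
      A + U p * B + g.toFun (φ p).1 * C = 0 := by
  have hφp : ContDiffAt ℝ ∞ φ p := hφ.contDiffAt (hΩ.mem_nhds hp)
  have hTp : ContDiffAt ℝ ∞ T p := by rw [hT]; exact hφp.fst.fst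
  have hXp : ContDiffAt ℝ ∞ X p := by rw [hX]; exact hφp.fst.snd
  have hUp : ContDiffAt ℝ ∞ U p := by rw [hU]; exact hφp.snd
  have hpdT : ∀ ξ, (fderiv ℝ φ p ξ).1.1 = pd ξ T p := by
    intro ξ
    rw [pd, hT, HasFDerivAt.fderiv (differentiableAt_of_smooth hφp).hasFDerivAt.fst.fst]; rfl
  have hpdX : ∀ ξ, (fderiv ℝ φ p ξ).1.2 = pd ξ X p := by
    intro ξ
    rw [pd, hX, HasFDerivAt.fderiv (differentiableAt_of_smooth hφp).hasFDerivAt.fst.snd]; rfl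
  have huc := contDiff_quad p a b r s
  have hfu : ∀ η : Plane, fderiv ℝ (quad p a b r s) p.1 η = a * η.1 + b * η.2 := by
    intro η
    have h1 : HasDerivAt (fun τ : ℝ => quad p a b r s (p.1 + τ • η))
        (fderiv ℝ (quad p a b r s) p.1 η) 0 := by
      have h2 : HasDerivAt (fun τ : ℝ => p.1 + τ • η) η 0 := by
        simpa using ((hasDerivAt_id (0 : ℝ)).smul_const η).const_add p.1
      have h3 : HasFDerivAt (quad p a b r s) (fderiv ℝ (quad p a b r s) p.1)
          ((fun τ : ℝ => p.1 + τ • η) 0) := by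
        simpa using (differentiableAt_of_smooth huc.contDiffAt).hasFDerivAt
      exact h3.comp_hasDerivAt (0 : ℝ) h2
    have h4 : (fun τ : ℝ => quad p a b r s (p.1 + τ • η)) = fun τ : ℝ =>
        p.2 + (a * η.1 + b * η.2) * (τ - 0) + (r * η.2 ^ 2 + s * η.1 ^ 2) / 2 * (τ - 0) ^ 2 := by
      funext τ; simp [quad]; ring
    rw [h4] at h1
    simpa using h1.unique (hasDerivAt_quadratic _ _ _ _ _)
  -- The quantity in `hΔ` is the determinant D_tT D_xX - D_xT D_tX of total derivatives on the
  -- graph, so the transversality condition follows by Cramer's rule.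
  obtain ⟨v, hv, htr⟩ := exists_transform hφp huc.contDiffAt (quad_self p a b r s) (by
    rintro ⟨η₁, η₂⟩ h
    rw [hfu] at h
    have hc : ∀ F, pd ((η₁, η₂), a * η₁ + b * η₂) F p =
        η₁ * pd ((1, 0), a) F p + η₂ * pd ((0, 1), b) F p := by
      intro F; rw [pd_comb, pd_comb F p 1 0 a, pd_comb F p 0 1 b]; ring
    have h1 := congrArg Prod.fst h
    have h2 := congrArg Prod.snd h
    simp only [hpdT, hpdX, hc, Prod.fst_zero, Prod.snd_zero] at h1 h2
    have h3 : η₁ = 0 := by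
      refine (mul_eq_zero.1 ?_).resolve_right hΔ
      linear_combination pd ((0, 1), b) X p * h1 - pd ((0, 1), b) T p * h2
    have h4 : η₂ = 0 := by
      refine (mul_eq_zero.1 ?_).resolve_right hΔ
      linear_combination pd ((1, 0), a) T p * h2 - pd ((1, 0), a) X p * h1
    simp [h3, h4])
  have hl := (hm p hp).2.2 _ v huc.contDiffAt hv (quad_self p a b r s) htr
    (by rw [lhs_quad]; exact hlhs)
  rw [lhs_eq hv] at hl
  have hvU : v (φ p).1 = U p := by
    have := htr.self_of_nhds
    rw [quad_self] at this
    rw [hU]; exact this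
  -- The identity v(T, X) = U is restricted to the line through p.1 in the direction (ξ₁, ξ₂), whose
  -- lift to the graph has the tangent vector ξ; `second_chain` then relates the 2-jets.
  have key : ∀ ξ₁ ξ₂ : ℝ, ∀ ξ : Space, ξ = ((ξ₁, ξ₂), a * ξ₁ + b * ξ₂) →
      pd ξ T p * fderiv ℝ v (φ p).1 (1, 0) + pd ξ X p * fderiv ℝ v (φ p).1 (0, 1) = pd ξ U p ∧
      (pd ξ T p = 0 → pd ξ X p ^ 2 * fderiv ℝ (fun y => fderiv ℝ v y (0, 1)) (φ p).1 (0, 1)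
        + (pd ξ (pd ξ T) p + (s * ξ₁ ^ 2 + r * ξ₂ ^ 2) * pd eu T p) * fderiv ℝ v (φ p).1 (1, 0)
        + (pd ξ (pd ξ X) p + (s * ξ₁ ^ 2 + r * ξ₂ ^ 2) * pd eu X p) * fderiv ℝ v (φ p).1 (0, 1)
        = pd ξ (pd ξ U) p + (s * ξ₁ ^ 2 + r * ξ₂ ^ 2) * pd eu U p) := by
    rintro ξ₁ ξ₂ ξ rfl
    obtain ⟨T', hT1, hT0, hT2⟩ := curve_derivs hTp ξ₁ ξ₂ (a * ξ₁ + b * ξ₂) (s * ξ₁ ^ 2 + r * ξ₂ ^ 2)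
    obtain ⟨X', hX1, hX0, hX2⟩ := curve_derivs hXp ξ₁ ξ₂ (a * ξ₁ + b * ξ₂) (s * ξ₁ ^ 2 + r * ξ₂ ^ 2)
    obtain ⟨U', hU1, hU0, hU2⟩ := curve_derivs hUp ξ₁ ξ₂ (a * ξ₁ + b * ξ₂) (s * ξ₁ ^ 2 + r * ξ₂ ^ 2)
    have hline : Filter.Tendsto (fun σ : ℝ => (p.1.1 + σ * ξ₁, p.1.2 + σ * ξ₂)) (𝓝 0) (𝓝 p.1) :=
      (continuous_fst.tendsto p).comp (continuous_graph_line p ξ₁ ξ₂ 0 0)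
    have hq : ∀ σ : ℝ, quad p a b r s (p.1.1 + σ * ξ₁, p.1.2 + σ * ξ₂) =
        p.2 + σ * (a * ξ₁ + b * ξ₂) + σ ^ 2 / 2 * (s * ξ₁ ^ 2 + r * ξ₂ ^ 2) := by
      intro σ; simp [quad]; ring
    have hv0 : (T ((p.1.1 + 0 * ξ₁, p.1.2 + 0 * ξ₂), p.2 + 0 * (a * ξ₁ + b * ξ₂)
          + 0 ^ 2 / 2 * (s * ξ₁ ^ 2 + r * ξ₂ ^ 2)),
        X ((p.1.1 + 0 * ξ₁, p.1.2 + 0 * ξ₂), p.2 + 0 * (a * ξ₁ + b * ξ₂)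
          + 0 ^ 2 / 2 * (s * ξ₁ ^ 2 + r * ξ₂ ^ 2))) = (φ p).1 := by
      simp [hT, hX]
    have hsc := second_chain (by rw [hv0]; exact hv) hT1 hT2 hX1 hX2 hU1 hU2 (by
      filter_upwards [hline.eventually htr] with σ hσ
      rw [hq] at hσ
      rw [hT, hX, hU]; exact hσ)
    simp only [hv0, hT0, hX0, hU0] at hsc
    exact hsc
  refine ⟨_, _, _, fun ξ₁ ξ₂ => (key ξ₁ ξ₂ _ rfl).1, fun ξ₁ ξ₂ ξ hξ => (key ξ₁ ξ₂ ξ hξ).2, ?_⟩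
  rw [← hvU]; exact hl

/-! ### Rules for partial derivatives -/

theorem pd_add {F G : Space → ℝ} {p : Space} (v : Space) (hF : DifferentiableAt ℝ F p)
    (hG : DifferentiableAt ℝ G p) : pd v (fun y => F y + G y) p = pd v F p + pd v G p := by
  rw [pd, fderiv_fun_add hF hG]; rfl

theorem pd_sub {F G : Space → ℝ} {p : Space} (v : Space) (hF : DifferentiableAt ℝ F p)
    (hG : DifferentiableAt ℝ G p) : pd v (fun y => F y - G y) p = pd v F p - pd v G p := by
  rw [pd, fderiv_fun_sub hF hG]; rfl

theorem pd_mul {F G : Space → ℝ} {p : Space} (v : Space) (hF : DifferentiableAt ℝ F p)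
    (hG : DifferentiableAt ℝ G p) :
    pd v (fun y => F y * G y) p = pd v F p * G p + F p * pd v G p := by
  rw [pd, fderiv_fun_mul hF hG]
  simp [pd]; ring

theorem pd_const (c : ℝ) (v p : Space) : pd v (fun _ => c) p = 0 := by simp [pd]

theorem pd_coord_u (v p : Space) : pd v (fun y => y.2) p = v.2 := by
  rw [pd, hasFDerivAt_snd.fderiv]; rfl

theorem pd_coord_t (v p : Space) : pd v (fun y => y.1.1) p = v.1.1 := by
  rw [pd, (hasFDerivAt_fst (𝕜 := ℝ) (p := p)).fst.fderiv]; rfl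

theorem pd_coord_x (v p : Space) : pd v (fun y => y.1.2) p = v.1.2 := by
  rw [pd, (hasFDerivAt_fst (𝕜 := ℝ) (p := p)).snd.fderiv]; rfl

/-- Identities valid throughout an open set may be differentiated; all differential consequences of
the determining equations come from this lemma and `pd_eq_zero`. -/
theorem pd_congr {F G : Space → ℝ} {Ω : Set Space} (hΩ : IsOpen Ω) (h : ∀ p ∈ Ω, F p = G p)
    (v : Space) {p : Space} (hp : p ∈ Ω) : pd v F p = pd v G p := by
  have : F =ᶠ[𝓝 p] G := Filter.mem_of_superset (hΩ.mem_nhds hp) h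
  rw [pd, this.fderiv_eq, pd]

theorem pd_eq_zero {F : Space → ℝ} {Ω : Set Space} (hΩ : IsOpen Ω) (h : ∀ p ∈ Ω, F p = 0)
    (v : Space) {p : Space} (hp : p ∈ Ω) : pd v F p = 0 := by
  rw [pd_congr hΩ h v hp, pd_const]

theorem pd_comm {F : Space → ℝ} {p : Space} (h : ContDiffAt ℝ ∞ F p) (v w : Space) :
    pd v (pd w F) p = pd w (pd v F) p := by
  have hs : IsSymmSndFDerivAt ℝ F p := h.isSymmSndFDerivAt (by
    rw [minSmoothness_of_isRCLikeNormedField]; exact WithTop.coe_le_coe.2 (le_top : (2 : ℕ∞) ≤ ⊤))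
  have h2 : DifferentiableAt ℝ (fderiv ℝ F) p :=
    (h.fderiv_right (m := ∞) (by simp)).differentiableAt (by simp)
  have h3 : ∀ v w, pd v (pd w F) p = fderiv ℝ (fderiv ℝ F) p v w := by
    intro v w
    have : HasFDerivAt (pd w F) _ p := h2.hasFDerivAt.clm_apply (hasFDerivAt_const w p)
    rw [pd, this.fderiv]; simp
  rw [h3, h3]; exact hs v w

/-- This is the part of the second total x-derivative that does not contain u_xx: b stands for the
frozen value of u_x. -/
theorem pd_pd_line {F : Space → ℝ} {p : Space} (h : ContDiffAt ℝ ∞ F p) (b : ℝ) :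
    pd ((0, 1), b) (pd ((0, 1), b) F) p =
      pd ex (pd ex F) p + 2 * b * pd ex (pd eu F) p + b ^ 2 * pd eu (pd eu F) p := by
  have h1 : pd ((0, 1), b) F = fun y => pd ex F y + b * pd eu F y := by
    funext y; rw [pd_comb]; ring
  have hx := differentiableAt_of_smooth (contDiffAt_pd h ex)
  have hu := differentiableAt_of_smooth (contDiffAt_pd h eu)
  rw [pd_comb, h1, pd_add _ hx (hu.const_mul b), pd_add _ hx (hu.const_mul b),
    pd_add _ hx (hu.const_mul b), pd_mul _ (by fun_prop) hu, pd_mul _ (by fun_prop) hu,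
    pd_mul _ (by fun_prop) hu, pd_const, pd_const, pd_const, pd_comm h eu ex]
  ring

/-! ### Splitting with respect to the jet variables -/

/-- The components of a smooth map with surjective differentials which sends the equation of `f`
to the equation of `g`. -/
structure Setting (Ω : Set Space) (φ : Space → Space) (f g : ArbitraryElement)
    (T X U : Space → ℝ) : Prop where
  isOpen : IsOpen Ω
  smooth : ContDiffOn ℝ ∞ φ Ω
  surj : ∀ p ∈ Ω, Function.Surjective (fderiv ℝ φ p)
  maps : MapsEquation Ω φ f g
  T_eq : T = fun p => (φ p).1.1
  X_eq : X = fun p => (φ p).1.2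
  U_eq : U = fun p => (φ p).2

namespace Setting

variable {Ω : Set Space} {φ : Space → Space} {f g : ArbitraryElement} {T X U : Space → ℝ}

theorem smoothT (h : Setting Ω φ f g T X U) {p : Space} (hp : p ∈ Ω) : ContDiffAt ℝ ∞ T p := by
  rw [h.T_eq]; exact (h.smooth.contDiffAt (h.isOpen.mem_nhds hp)).fst.fst

theorem smoothX (h : Setting Ω φ f g T X U) {p : Space} (hp : p ∈ Ω) : ContDiffAt ℝ ∞ X p := by
  rw [h.X_eq]; exact (h.smooth.contDiffAt (h.isOpen.mem_nhds hp)).fst.snd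

theorem smoothU (h : Setting Ω φ f g T X U) {p : Space} (hp : p ∈ Ω) : ContDiffAt ℝ ∞ U p := by
  rw [h.U_eq]; exact (h.smooth.contDiffAt (h.isOpen.mem_nhds hp)).snd

theorem f_ne (h : Setting Ω φ f g T X U) {p : Space} (hp : p ∈ Ω) : f.toFun p.1 ≠ 0 :=
  f.ne_zero _ (h.maps p hp).1

theorem g_ne (h : Setting Ω φ f g T X U) {p : Space} (hp : p ∈ Ω) : g.toFun (φ p).1 ≠ 0 :=
  g.ne_zero _ (h.maps p hp).2.1

theorem exists_preimage (h : Setting Ω φ f g T X U) {p : Space} (hp : p ∈ Ω) (a b c : ℝ) :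
    ∃ ξ : Space, pd ξ T p = a ∧ pd ξ X p = b ∧ pd ξ U p = c := by
  obtain ⟨ξ, hξ⟩ := h.surj p hp ((a, b), c)
  have hφp := (differentiableAt_of_smooth (h.smooth.contDiffAt (h.isOpen.mem_nhds hp))).hasFDerivAt
  refine ⟨ξ, ?_, ?_, ?_⟩
  · rw [pd, h.T_eq, HasFDerivAt.fderiv hφp.fst.fst]
    exact congrArg (fun y : Space => y.1.1) hξ
  · rw [pd, h.X_eq, HasFDerivAt.fderiv hφp.fst.snd]
    exact congrArg (fun y : Space => y.1.2) hξ
  · rw [pd, h.U_eq, HasFDerivAt.fderiv hφp.snd]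
    exact congrArg (fun y : Space => y.2) hξ

/-- The equation does not restrict u_tt, so two jets differing only in u_tt (s = 0 and s = 1) must
both be sent to solutions. They have the same v_T and v_X, and hence, as g ≠ 0, the same v_XX. The
second-order relation sees u_tt unless D_xT = 0. -/
theorem pd_T_eq_zero_of_transversal (h : Setting Ω φ f g T X U) {p : Space} (hp : p ∈ Ω) {a b : ℝ}
    (hΔ : pd ((1, 0), a) T p * pd ((0, 1), b) X p - pd ((0, 1), b) T p * pd ((1, 0), a) X p ≠ 0) :
    pd ((0, 1), b) T p = 0 := by
  have hf := h.f_ne hp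
  have hlhs : a + p.2 * b + f.toFun p.1 * (-(a + p.2 * b) / f.toFun p.1) = 0 := by
    field_simp; ring
  obtain ⟨A, B, C, h1, h2, h3⟩ := jet_relations (s := 0) h.isOpen h.smooth h.maps h.T_eq h.X_eq h.U_eq
    hp hlhs hΔ
  obtain ⟨A', B', C', h1', h2', h3'⟩ := jet_relations (s := 1) h.isOpen h.smooth h.maps h.T_eq
    h.X_eq h.U_eq hp hlhs hΔ
  set r := -(a + p.2 * b) / f.toFun p.1
  have et1 := h1 1 0
  have ex1 := h1 0 1
  have et2 := h1' 1 0
  have ex2 := h1' 0 1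
  simp only [mul_one, mul_zero, add_zero, zero_add] at et1 ex1 et2 ex2
  have hA : A' = A := by
    refine sub_eq_zero.1 ((mul_eq_zero.1 ?_).resolve_left hΔ)
    linear_combination pd ((0, 1), b) X p * (et2 - et1) - pd ((1, 0), a) X p * (ex2 - ex1)
  have hB : B' = B := by
    refine sub_eq_zero.1 ((mul_eq_zero.1 ?_).resolve_left hΔ)
    linear_combination pd ((1, 0), a) T p * (ex2 - ex1) - pd ((0, 1), b) T p * (et2 - et1)
  subst hA hB
  have hC : C' = C := by
    refine sub_eq_zero.1 ((mul_eq_zero.1 ?_).resolve_left (h.g_ne hp))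
    linear_combination h3' - h3
  subst hC
  set D := pd ((0, 1), b) T p
  set E := pd ((1, 0), a) T p
  -- The direction (-D, E) is tangent to the level line of T on the graph, where v_XX is the only
  -- second derivative involved.
  have hz : pd ((-D, E), a * (-D) + b * E) T p = 0 := by
    have : pd ((-D, E), a * (-D) + b * E) T p =
        (-D) * pd ((1, 0), a) T p + E * pd ((0, 1), b) T p := by
      rw [pd_comb, pd_comb T p 1 0 a, pd_comb T p 0 1 b]; ring
    rw [this]; ring
  have k1 := h2 _ _ _ rfl hz
  have k2 := h2' _ _ _ rfl hz
  have k3 : D ^ 2 * (pd eu T p * A' + pd eu X p * B' - pd eu U p) = 0 := by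
    linear_combination k2 - k1
  -- If the other factor vanished, the image of the differential of φ would lie in the plane dU = A'
  -- dT + B' dX, contrary to surjectivity.
  refine (pow_eq_zero_iff (two_ne_zero)).1 ((mul_eq_zero.1 k3).resolve_right fun k4 => ?_)
  obtain ⟨ξ, hξT, hξX, hξU⟩ := h.exists_preimage hp 0 0 1
  obtain ⟨⟨ξ₁, ξ₂⟩, ξ₃⟩ := ξ
  have k5 := h1 ξ₁ ξ₂
  rw [pd_comb] at hξT hξX hξU
  simp only [pd_comb _ _ ξ₁] at k5
  have : (0 : ℝ) = 1 := by
    linear_combination k5 + (ξ₃ - (a * ξ₁ + b * ξ₂)) * k4 - A' * hξT - B' * hξX + hξU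
  exact zero_ne_one this

/-- Two values of b with a common a are needed to separate T_x from T_u in T_x + b T_u = 0. -/
theorem _root_.GBE.exists_affine_ne_zero {c₀ c₁ c₂ : ℝ} (h : ¬ (c₀ = 0 ∧ c₁ = 0 ∧ c₂ = 0)) :
    ∃ a b b' : ℝ, b ≠ b' ∧ c₀ + c₁ * a + c₂ * b ≠ 0 ∧ c₀ + c₁ * a + c₂ * b' ≠ 0 := by
  by_cases h2 : c₂ = 0
  · by_cases h1 : c₁ = 0
    · have h0 : c₀ ≠ 0 := fun h0 => h ⟨h0, h1, h2⟩
      exact ⟨0, 0, 1, by norm_num, by simpa [h1, h2], by simpa [h1, h2]⟩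
    · have e : c₀ + c₁ * ((1 - c₀) / c₁) = 1 := by field_simp; ring
      exact ⟨(1 - c₀) / c₁, 0, 1, by norm_num, by simp [e], by simp [h2, e]⟩
  · have e : ∀ k : ℝ, c₀ + c₁ * 0 + c₂ * ((k - c₀) / c₂) = k := by intro k; field_simp; ring
    refine ⟨0, (1 - c₀) / c₂, (2 - c₀) / c₂, ?_, by rw [e]; norm_num, by rw [e]; norm_num⟩
    intro hh
    have := (e 1).symm.trans (hh ▸ e 2)
    norm_num at this

theorem pd_T_eq_zero (h : Setting Ω φ f g T X U) {p : Space} (hp : p ∈ Ω) :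
    pd ex T p = 0 ∧ pd eu T p = 0 := by
  -- The bilinear terms in a and b cancel in the transversality determinant, so it is affine in (a,
  -- b); its coefficients are the 2×2 minors of d(T, X), which has rank 2.
  have hne : ¬ (pd et T p * pd ex X p - pd ex T p * pd et X p = 0 ∧
      pd eu T p * pd ex X p - pd ex T p * pd eu X p = 0 ∧
      pd et T p * pd eu X p - pd eu T p * pd et X p = 0) := by
    rintro ⟨h0, h1, h2⟩
    obtain ⟨⟨⟨a₁, a₂⟩, a₃⟩, haT, haX, -⟩ := h.exists_preimage hp 1 0 0
    obtain ⟨⟨⟨b₁, b₂⟩, b₃⟩, hbT, hbX, -⟩ := h.exists_preimage hp 0 1 0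
    have e : pd ((a₁, a₂), a₃) T p * pd ((b₁, b₂), b₃) X p
        - pd ((a₁, a₂), a₃) X p * pd ((b₁, b₂), b₃) T p = 0 := by
      simp only [pd_comb _ _ a₁, pd_comb _ _ b₁]
      linear_combination (a₁ * b₂ - a₂ * b₁) * h0 + (a₃ * b₂ - a₂ * b₃) * h1
        + (a₁ * b₃ - a₃ * b₁) * h2
    rw [haT, haX, hbT, hbX] at e
    norm_num at e
  obtain ⟨a, b, b', hb, h1, h2⟩ := exists_affine_ne_zero hne
  have key : ∀ b : ℝ, pd et T p * pd ex X p - pd ex T p * pd et X p +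
      (pd eu T p * pd ex X p - pd ex T p * pd eu X p) * a +
      (pd et T p * pd eu X p - pd eu T p * pd et X p) * b ≠ 0 → pd ex T p + b * pd eu T p = 0 := by
    intro b hb
    have := h.pd_T_eq_zero_of_transversal hp (a := a) (b := b) (by
      convert hb using 1
      simp only [pd_comb _ _ 1 0 a, pd_comb _ _ 0 1 b]
      ring)
    rw [pd_comb] at this
    linear_combination this
  have k1 := key b h1
  have k2 := key b' h2
  have k3 : pd eu T p = 0 := by
    refine (mul_eq_zero.1 ?_).resolve_left (sub_ne_zero.2 hb)
    linear_combination k1 - k2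
  exact ⟨by linear_combination k1 - b * k3, k3⟩

theorem Tt_ne (h : Setting Ω φ f g T X U) {p : Space} (hp : p ∈ Ω) : pd et T p ≠ 0 := by
  obtain ⟨⟨⟨a₁, a₂⟩, a₃⟩, haT, -, -⟩ := h.exists_preimage hp 1 0 0
  rw [pd_comb, (h.pd_T_eq_zero hp).1, (h.pd_T_eq_zero hp).2] at haT
  intro h0
  rw [h0] at haT
  norm_num at haT

/-- Once T depends on t alone, the full Jacobian is, up to sign, T_t times this minor. -/
theorem jacobian_ne (h : Setting Ω φ f g T X U) {p : Space} (hp : p ∈ Ω) :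
    pd eu U p * pd ex X p - pd eu X p * pd ex U p ≠ 0 := by
  obtain ⟨⟨⟨a₁, a₂⟩, a₃⟩, haT, haX, haU⟩ := h.exists_preimage hp 0 1 0
  obtain ⟨⟨⟨b₁, b₂⟩, b₃⟩, hbT, hbX, hbU⟩ := h.exists_preimage hp 0 0 1
  rw [pd_comb, (h.pd_T_eq_zero hp).1, (h.pd_T_eq_zero hp).2] at haT hbT
  rw [pd_comb] at haX haU hbX hbU
  have ha : a₁ = 0 := by simpa [h.Tt_ne hp] using haT
  have hb : b₁ = 0 := by simpa [h.Tt_ne hp] using hbT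
  subst ha hb
  intro h0
  have : (1 : ℝ) = 0 := by
    linear_combination (a₂ * b₃ - a₃ * b₂) * h0 + (b₂ * pd ex U p + b₃ * pd eu U p) * (-haX)
      - hbU + haU * (b₂ * pd ex X p + b₃ * pd eu X p)
  exact one_ne_zero this

/-- The transformed equation as a condition for the derivatives of the components of the
transformation and for the jet variables `b = u_x`, `r = u_xx`. -/
theorem jet_equation (h : Setting Ω φ f g T X U) {p : Space} (hp : p ∈ Ω) {b : ℝ} (r : ℝ)
    (hb : pd ex X p + b * pd eu X p ≠ 0) :
    (pd ex X p + b * pd eu X p) ^ 3 * (pd et U p + (-p.2 * b - f.toFun p.1 * r) * pd eu U p)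
    + (pd ex X p + b * pd eu X p) ^ 2 * (pd ex U p + b * pd eu U p) *
      (pd et T p * U p - pd et X p - (-p.2 * b - f.toFun p.1 * r) * pd eu X p)
    + pd et T p * g.toFun (φ p).1 *
      ((pd ex X p + b * pd eu X p) *
        (pd ex (pd ex U) p + 2 * b * pd ex (pd eu U) p + b ^ 2 * pd eu (pd eu U) p + r * pd eu U p)
      - (pd ex U p + b * pd eu U p) *
        (pd ex (pd ex X) p + 2 * b * pd ex (pd eu X) p + b ^ 2 * pd eu (pd eu X) p + r * pd eu X p))
      = 0 := by
  obtain ⟨hTx, hTu⟩ := h.pd_T_eq_zero hp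
  have hTb : ∀ y ∈ Ω, pd ((0, 1), b) T y = 0 := by
    intro y hy
    rw [pd_comb, (h.pd_T_eq_zero hy).1, (h.pd_T_eq_zero hy).2]; ring
  set a := -p.2 * b - f.toFun p.1 * r with ha
  obtain ⟨A, B, C, h1, h2, h3⟩ := jet_relations (s := 0) (a := a) (b := b) (r := r)
    h.isOpen h.smooth h.maps h.T_eq h.X_eq h.U_eq hp (by rw [ha]; ring) (by
      rw [hTb p hp, pd_comb, pd_comb X p 0 1 b, hTx, hTu]
      have := mul_ne_zero (h.Tt_ne hp) hb
      convert this using 1; ring)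
  have e1 := h1 1 0
  have e2 := h1 0 1
  have e3 := h2 0 1 ((0, 1), b) (by simp) (hTb p hp)
  rw [pd_eq_zero h.isOpen hTb _ hp, pd_pd_line (h.smoothX hp), pd_pd_line (h.smoothU hp), hTu] at e3
  simp only [pd_comb, hTx, hTu] at e1 e2 e3
  have hX : pd ((0, 1), b) X p = pd ex X p + b * pd eu X p := by rw [pd_comb]; ring
  -- The first-order relations and the relation for v_XX eliminate A, B, C from the transformed
  -- equation, cleared of denominators by T_t (D_xX)^3.
  linear_combination (-(pd ex X p + b * pd eu X p) ^ 3) * e1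
    + ((pd ex X p + b * pd eu X p) ^ 2 * (pd et X p + a * pd eu X p)
      - (pd ex X p + b * pd eu X p) ^ 2 * pd et T p * U p
      + pd et T p * g.toFun (φ p).1 *
        (pd ex (pd ex X) p + 2 * b * pd ex (pd eu X) p + b ^ 2 * pd eu (pd eu X) p + r * pd eu X p))
      * e2
    - pd et T p * g.toFun (φ p).1 * (pd ex X p + b * pd eu X p) * e3
    + pd et T p * (pd ex X p + b * pd eu X p) ^ 3 * h3

/-- `jet_equation` is affine in r = u_xx; its r-coefficient is this difference times the nonzero
minor from `jacobian_ne`. -/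
theorem g_relation (h : Setting Ω φ f g T X U) {p : Space} (hp : p ∈ Ω) {b : ℝ}
    (hb : pd ex X p + b * pd eu X p ≠ 0) :
    pd et T p * g.toFun (φ p).1 = f.toFun p.1 * (pd ex X p + b * pd eu X p) ^ 2 := by
  have h0 := h.jet_equation hp 0 hb
  have h1 := h.jet_equation hp 1 hb
  refine sub_eq_zero.1 ((mul_eq_zero.1 ?_).resolve_left (h.jacobian_ne hp))
  linear_combination h1 - h0

theorem Xu_eq_zero (h : Setting Ω φ f g T X U) {p : Space} (hp : p ∈ Ω) : pd eu X p = 0 := by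
  by_contra hne
  -- If X_u ≠ 0, then D_xX can be given the values 1 and 2 by the choice of b, while T_t g stays the
  -- same; this gives 3 f = 0.
  have e : ∀ k : ℝ, pd ex X p + (k - pd ex X p) / pd eu X p * pd eu X p = k := by
    intro k; field_simp; ring
  have h1 := h.g_relation hp (b := (1 - pd ex X p) / pd eu X p) (by rw [e]; norm_num)
  have h2 := h.g_relation hp (b := (2 - pd ex X p) / pd eu X p) (by rw [e]; norm_num)
  rw [e] at h1 h2
  exact h.f_ne hp (by linear_combination (h1 - h2) / 3)

theorem Xx_ne (h : Setting Ω φ f g T X U) {p : Space} (hp : p ∈ Ω) : pd ex X p ≠ 0 := by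
  intro h0
  exact h.jacobian_ne hp (by rw [h0, h.Xu_eq_zero hp]; ring)

theorem Uu_ne (h : Setting Ω φ f g T X U) {p : Space} (hp : p ∈ Ω) : pd eu U p ≠ 0 := by
  intro h0
  exact h.jacobian_ne hp (by rw [h0, h.Xu_eq_zero hp]; ring)

theorem g_eq (h : Setting Ω φ f g T X U) {p : Space} (hp : p ∈ Ω) :
    pd et T p * g.toFun (φ p).1 = f.toFun p.1 * pd ex X p ^ 2 := by
  have := h.g_relation hp (b := 0) (by simpa using h.Xx_ne hp)
  simpa using this

/-- With X_u = 0 and g expressed through f, the jet equation at u_xx = 0 is quadratic in u_x. The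
three equations are its coefficients, recovered from the values at 0, 1, -1. -/
theorem splitting (h : Setting Ω φ f g T X U) {p : Space} (hp : p ∈ Ω) :
    pd eu (pd eu U) p = 0 ∧
    pd eu U p * (pd et T p * U p - pd et X p - p.2 * pd ex X p)
      + f.toFun p.1 * (2 * pd ex (pd eu U) p * pd ex X p - pd eu U p * pd ex (pd ex X) p) = 0 ∧
    pd et U p * pd ex X p + pd ex U p * (pd et T p * U p - pd et X p)
      + f.toFun p.1 * (pd ex (pd ex U) p * pd ex X p - pd ex U p * pd ex (pd ex X) p) = 0 := by
  have hX := h.Xx_ne hp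
  have hXu := h.Xu_eq_zero hp
  have hb : ∀ b, pd ex X p + b * pd eu X p ≠ 0 := by intro b; rw [hXu]; simpa using hX
  have z1 : pd ex (pd eu X) p = 0 := pd_eq_zero h.isOpen (fun y hy => h.Xu_eq_zero hy) _ hp
  have z2 : pd eu (pd eu X) p = 0 := pd_eq_zero h.isOpen (fun y hy => h.Xu_eq_zero hy) _ hp
  have hg := h.g_eq hp
  have h0 := h.jet_equation hp 0 (hb 0)
  have h1 := h.jet_equation hp 0 (hb 1)
  have h2 := h.jet_equation hp 0 (hb (-1))
  simp only [hXu, z1, z2, hg] at h0 h1 h2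
  refine ⟨?_, ?_, ?_⟩
  · refine (mul_eq_zero.1 ?_).resolve_left (mul_ne_zero (h.f_ne hp) (pow_ne_zero 3 hX))
    linear_combination (h1 + h2 - 2 * h0) / 2
  · refine (mul_eq_zero.1 ?_).resolve_left (pow_ne_zero 2 hX)
    linear_combination (h1 - h2) / 2
  · refine (mul_eq_zero.1 ?_).resolve_left (pow_ne_zero 2 hX)
    linear_combination h0

end Setting

/-! ### Differential consequences free of the arbitrary elements -/

namespace Setting

variable {Ω : Set Space} {φ : Space → Space} {f g : ArbitraryElement} {T X U : Space → ℝ}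

theorem differentiableAt_f (h : Setting Ω φ f g T X U) {p : Space} (hp : p ∈ Ω) :
    DifferentiableAt ℝ (fun y : Space => f.toFun y.1) p := by
  have h1 : ContDiffAt ℝ ∞ f.toFun p.1 :=
    f.smooth.contDiffAt (f.isOpen_domain.mem_nhds (h.maps p hp).1)
  exact (differentiableAt_of_smooth h1).comp p differentiableAt_fst

theorem pd_u_f (h : Setting Ω φ f g T X U) {p : Space} (hp : p ∈ Ω) :
    pd eu (fun y : Space => f.toFun y.1) p = 0 := by
  have h1 : ContDiffAt ℝ ∞ f.toFun p.1 :=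
    f.smooth.contDiffAt (f.isOpen_domain.mem_nhds (h.maps p hp).1)
  have h2 : HasFDerivAt (fun y : Space => f.toFun y.1) _ p :=
    (differentiableAt_of_smooth h1).hasFDerivAt.comp p hasFDerivAt_fst
  rw [pd, h2.fderiv]
  simp only [ContinuousLinearMap.comp_apply, eu, ContinuousLinearMap.coe_fst']
  exact map_zero _

theorem Uuu_eq_zero (h : Setting Ω φ f g T X U) {p : Space} (hp : p ∈ Ω) :
    pd eu (pd eu U) p = 0 := (h.splitting hp).1

/-- Differentiating the second equation of `splitting` with respect to u kills the whole f-term,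
because U_uu = X_u = 0 and f does not depend on u. -/
theorem Uu_eq (h : Setting Ω φ f g T X U) {p : Space} (hp : p ∈ Ω) :
    pd et T p * pd eu U p = pd ex X p := by
  have hT := h.smoothT hp
  have hX := h.smoothX hp
  have hU := h.smoothU hp
  have d1 := differentiableAt_of_smooth hU
  have d2 := differentiableAt_of_smooth (contDiffAt_pd hU eu)
  have d3 := differentiableAt_of_smooth (contDiffAt_pd hT et)
  have d4 := differentiableAt_of_smooth (contDiffAt_pd hX et)
  have d5 := differentiableAt_of_smooth (contDiffAt_pd hX ex)
  have d6 := differentiableAt_of_smooth (contDiffAt_pd (contDiffAt_pd hX ex) ex)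
  have d7 := differentiableAt_of_smooth (contDiffAt_pd (contDiffAt_pd hU eu) ex)
  have d8 := h.differentiableAt_f hp
  have d9 : DifferentiableAt ℝ (fun y : Space => y.2) p := differentiableAt_snd
  have e := pd_eq_zero h.isOpen (fun y hy => (h.splitting hy).2.1) eu hp
  rw [pd_add _ (by fun_prop) (by fun_prop), pd_mul _ d2 (by fun_prop), pd_mul _ d8 (by fun_prop),
    pd_sub _ (by fun_prop) (by fun_prop), pd_sub _ (by fun_prop) (by fun_prop), pd_mul _ d3 d1,
    pd_mul _ d9 d5, pd_sub _ (by fun_prop) (by fun_prop), pd_mul _ (by fun_prop) d5,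
    pd_mul _ (by fun_prop) d7, pd_mul _ d2 d6, pd_const, h.pd_u_f hp, h.Uuu_eq_zero hp,
    pd_comm hT eu et, pd_comm hX eu et, pd_comm hX eu ex, pd_comm (contDiffAt_pd hX ex) eu ex,
    pd_comm (contDiffAt_pd hU eu) eu ex,
    pd_eq_zero h.isOpen (fun y hy => (h.pd_T_eq_zero hy).2) et hp,
    pd_eq_zero h.isOpen (fun y hy => h.Xu_eq_zero hy) et hp,
    pd_eq_zero h.isOpen (fun y hy => h.Xu_eq_zero hy) ex hp,
    pd_eq_zero h.isOpen (fun y hy => h.Uuu_eq_zero hy) ex hp,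
    pd_eq_zero h.isOpen (fun y hy => (pd_comm (h.smoothX hy) eu ex).trans
      (pd_eq_zero h.isOpen (fun y hy => h.Xu_eq_zero hy) ex hy)) ex hp, pd_coord_u] at e
  refine sub_eq_zero.1 ((mul_eq_zero.1 ?_).resolve_left (h.Uu_ne hp))
  simp only [eu] at e ⊢
  linear_combination e

/-- The third equation of `splitting` is quadratic in u; its second u-derivative reduces to 2 T_t
U_u U_xu = 0. -/
theorem Uux_eq_zero (h : Setting Ω φ f g T X U) {p : Space} (hp : p ∈ Ω) :
    pd ex (pd eu U) p = 0 := by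
  have hXuz : ∀ y ∈ Ω, ∀ v, pd v (pd eu X) y = 0 := fun y hy v =>
    pd_eq_zero h.isOpen (fun y hy => h.Xu_eq_zero hy) v hy
  have hXxuz : ∀ y ∈ Ω, pd eu (pd ex X) y = 0 := fun y hy =>
    (pd_comm (h.smoothX hy) eu ex).trans (hXuz y hy ex)
  have hUuuz : ∀ y ∈ Ω, ∀ v, pd v (pd eu (pd eu U)) y = 0 := fun y hy v =>
    pd_eq_zero h.isOpen (fun y hy => h.Uuu_eq_zero hy) v hy
  have first : ∀ y ∈ Ω, pd eu (pd et U) y * pd ex X y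
      + (pd eu (pd ex U) y * (pd et T y * U y - pd et X y) + pd ex U y * (pd et T y * pd eu U y))
      + f.toFun y.1 * (pd eu (pd ex (pd ex U)) y * pd ex X y - pd eu (pd ex U) y * pd ex (pd ex X) y)
      = 0 := by
    intro p hp
    have hT := h.smoothT hp
    have hX := h.smoothX hp
    have hU := h.smoothU hp
    have d1 := differentiableAt_of_smooth hU
    have d2 := differentiableAt_of_smooth (contDiffAt_pd hU et)
    have d2' := differentiableAt_of_smooth (contDiffAt_pd hU ex)
    have d3 := differentiableAt_of_smooth (contDiffAt_pd hT et)
    have d4 := differentiableAt_of_smooth (contDiffAt_pd hX et)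
    have d5 := differentiableAt_of_smooth (contDiffAt_pd hX ex)
    have d6 := differentiableAt_of_smooth (contDiffAt_pd (contDiffAt_pd hX ex) ex)
    have d7 := differentiableAt_of_smooth (contDiffAt_pd (contDiffAt_pd hU ex) ex)
    have d8 := h.differentiableAt_f hp
    have e := pd_eq_zero h.isOpen (fun y hy => (h.splitting hy).2.2) eu hp
    rw [pd_add _ (by fun_prop) (by fun_prop), pd_add _ (by fun_prop) (by fun_prop),
      pd_mul _ d2 d5, pd_mul _ d2' (by fun_prop), pd_mul _ d8 (by fun_prop),
      pd_sub _ (by fun_prop) (by fun_prop), pd_mul _ d3 d1,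
      pd_sub _ (by fun_prop) (by fun_prop), pd_mul _ d7 d5,
      pd_mul _ d2' d6, h.pd_u_f hp, hXxuz p hp,
      pd_comm hT eu et, pd_comm hX eu et, pd_comm (contDiffAt_pd hX ex) eu ex,
      pd_eq_zero h.isOpen (fun y hy => (h.pd_T_eq_zero hy).2) et hp, hXuz p hp et,
      pd_eq_zero h.isOpen hXxuz ex hp] at e
    linear_combination e
  have hT := h.smoothT hp
  have hX := h.smoothX hp
  have hU := h.smoothU hp
  have d1 := differentiableAt_of_smooth hU
  have d0 := differentiableAt_of_smooth (contDiffAt_pd hU eu)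
  have d0' := differentiableAt_of_smooth (contDiffAt_pd hU ex)
  have d2 := differentiableAt_of_smooth (contDiffAt_pd (contDiffAt_pd hU et) eu)
  have d2' := differentiableAt_of_smooth (contDiffAt_pd (contDiffAt_pd hU ex) eu)
  have d3 := differentiableAt_of_smooth (contDiffAt_pd hT et)
  have d4 := differentiableAt_of_smooth (contDiffAt_pd hX et)
  have d5 := differentiableAt_of_smooth (contDiffAt_pd hX ex)
  have d6 := differentiableAt_of_smooth (contDiffAt_pd (contDiffAt_pd hX ex) ex)
  have d7 := differentiableAt_of_smooth
    (contDiffAt_pd (contDiffAt_pd (contDiffAt_pd hU ex) ex) eu)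
  have d8 := h.differentiableAt_f hp
  have huut : pd eu (pd eu (pd et U)) p = 0 := by
    rw [pd_congr h.isOpen (fun y hy => pd_comm (h.smoothU hy) eu et) eu hp,
      pd_comm (contDiffAt_pd hU eu), hUuuz p hp]
  have huux : ∀ y ∈ Ω, pd eu (pd eu (pd ex U)) y = 0 := by
    intro y hy
    rw [pd_congr h.isOpen (fun y hy => pd_comm (h.smoothU hy) eu ex) eu hy,
      pd_comm (contDiffAt_pd (h.smoothU hy) eu), hUuuz y hy]
  have huuxx : pd eu (pd eu (pd ex (pd ex U))) p = 0 := by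
    rw [pd_congr h.isOpen (fun y hy => pd_comm (contDiffAt_pd (h.smoothU hy) ex) eu ex) eu hp,
      pd_comm (contDiffAt_pd (contDiffAt_pd hU ex) eu), pd_eq_zero h.isOpen huux ex hp]
  have e := pd_eq_zero h.isOpen first eu hp
  rw [pd_add _ (by fun_prop) (by fun_prop), pd_add _ (by fun_prop) (by fun_prop),
    pd_add _ (by fun_prop) (by fun_prop), pd_mul _ d2 d5, pd_mul _ d2' (by fun_prop),
    pd_mul _ d0' (by fun_prop), pd_mul _ d8 (by fun_prop),
    pd_sub _ (by fun_prop) (by fun_prop), pd_mul _ d3 d1, pd_mul _ d3 d0,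
    pd_sub _ (by fun_prop) (by fun_prop), pd_mul _ d7 d5,
    pd_mul _ d2' d6, h.pd_u_f hp, hXxuz p hp, huut, huux p hp, huuxx, h.Uuu_eq_zero hp,
    pd_comm hT eu et, pd_comm hX eu et, pd_comm (contDiffAt_pd hX ex) eu ex,
    pd_eq_zero h.isOpen (fun y hy => (h.pd_T_eq_zero hy).2) et hp, hXuz p hp et,
    pd_eq_zero h.isOpen hXxuz ex hp, pd_comm hU eu ex] at e
  refine (mul_eq_zero.1 ?_).resolve_left (mul_ne_zero (h.Tt_ne hp) (h.Uu_ne hp))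
  linear_combination e / 2

theorem Ttx_eq_zero (h : Setting Ω φ f g T X U) {p : Space} (hp : p ∈ Ω) :
    pd ex (pd et T) p = 0 := by
  rw [pd_comm (h.smoothT hp)]
  exact pd_eq_zero h.isOpen (fun y hy => (h.pd_T_eq_zero hy).1) et hp

theorem Xxx_eq_zero (h : Setting Ω φ f g T X U) {p : Space} (hp : p ∈ Ω) :
    pd ex (pd ex X) p = 0 := by
  rw [← pd_congr h.isOpen (fun y hy => h.Uu_eq hy) ex hp,
    pd_mul _ (differentiableAt_of_smooth (contDiffAt_pd (h.smoothT hp) et))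
      (differentiableAt_of_smooth (contDiffAt_pd (h.smoothU hp) eu)), h.Ttx_eq_zero hp,
    h.Uux_eq_zero hp]
  ring

theorem U_relation (h : Setting Ω φ f g T X U) {p : Space} (hp : p ∈ Ω) :
    pd et T p * U p = pd et X p + p.2 * pd ex X p := by
  have := (h.splitting hp).2.1
  rw [h.Uux_eq_zero hp, h.Xxx_eq_zero hp] at this
  refine sub_eq_zero.1 ((mul_eq_zero.1 ?_).resolve_left (h.Uu_ne hp))
  linear_combination this

theorem Ux_eq (h : Setting Ω φ f g T X U) {p : Space} (hp : p ∈ Ω) :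
    pd et T p * pd ex U p = pd ex (pd et X) p := by
  have e := pd_congr h.isOpen (fun y hy => h.U_relation hy) ex hp
  have d5 := differentiableAt_of_smooth (contDiffAt_pd (h.smoothX hp) ex)
  have d9 : DifferentiableAt ℝ (fun y : Space => y.2) p := differentiableAt_snd
  rw [pd_mul _ (differentiableAt_of_smooth (contDiffAt_pd (h.smoothT hp) et))
      (differentiableAt_of_smooth (h.smoothU hp)),
    pd_add _ (differentiableAt_of_smooth (contDiffAt_pd (h.smoothX hp) et)) (by fun_prop),
    pd_mul _ d9 d5, h.Ttx_eq_zero hp, h.Xxx_eq_zero hp, pd_coord_u] at e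
  simp only [ex] at e ⊢
  linear_combination e

theorem Uxx_eq_zero (h : Setting Ω φ f g T X U) {p : Space} (hp : p ∈ Ω) :
    pd ex (pd ex U) p = 0 := by
  have e := pd_congr h.isOpen (fun y hy => h.Ux_eq hy) ex hp
  rw [pd_mul _ (differentiableAt_of_smooth (contDiffAt_pd (h.smoothT hp) et))
      (differentiableAt_of_smooth (contDiffAt_pd (h.smoothU hp) ex)), h.Ttx_eq_zero hp,
      pd_congr h.isOpen (fun y hy => pd_comm (h.smoothX hy) ex et) ex hp,
      pd_comm (contDiffAt_pd (h.smoothX hp) ex) ex et,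
      pd_eq_zero h.isOpen (fun y hy => h.Xxx_eq_zero hy) et hp] at e
  refine (mul_eq_zero.1 ?_).resolve_left (h.Tt_ne hp)
  linear_combination e

/-- The f-terms have gone from the third equation of `splitting`, and T_t U - X_t = u X_x turns the
remainder into X_x (U_t + u U_x). -/
theorem Ut_eq (h : Setting Ω φ f g T X U) {p : Space} (hp : p ∈ Ω) :
    pd et U p + p.2 * pd ex U p = 0 := by
  have e := (h.splitting hp).2.2
  rw [h.Uxx_eq_zero hp, h.Xxx_eq_zero hp] at e
  refine (mul_eq_zero.1 ?_).resolve_left (h.Xx_ne hp)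
  linear_combination e - pd ex U p * h.U_relation hp

end Setting

/-! ### Integration of the determining equations -/

/-- The determining equations for admissible transformations that do not involve the arbitrary
elements. -/
structure Determining (Ω : Set Space) (T X U : Space → ℝ) : Prop where
  smoothT : ∀ p ∈ Ω, ContDiffAt ℝ ∞ T p
  smoothX : ∀ p ∈ Ω, ContDiffAt ℝ ∞ X p
  smoothU : ∀ p ∈ Ω, ContDiffAt ℝ ∞ U p
  Tx : ∀ p ∈ Ω, pd ex T p = 0
  Tu : ∀ p ∈ Ω, pd eu T p = 0
  Xu : ∀ p ∈ Ω, pd eu X p = 0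
  Xx : ∀ p ∈ Ω, pd ex X p ≠ 0
  Uu : ∀ p ∈ Ω, pd eu U p ≠ 0
  Uuu : ∀ p ∈ Ω, pd eu (pd eu U) p = 0
  Uux : ∀ p ∈ Ω, pd ex (pd eu U) p = 0
  Uxx : ∀ p ∈ Ω, pd ex (pd ex U) p = 0
  Ut : ∀ p ∈ Ω, pd et U p + p.2 * pd ex U p = 0
  TU : ∀ p ∈ Ω, pd et T p * U p = pd et X p + p.2 * pd ex X p
  TUu : ∀ p ∈ Ω, pd et T p * pd eu U p = pd ex X p

theorem Setting.determining {Ω : Set Space} {φ : Space → Space} {f g : ArbitraryElement}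
    {T X U : Space → ℝ} (h : Setting Ω φ f g T X U) : Determining Ω T X U where
  smoothT _ hp := h.smoothT hp
  smoothX _ hp := h.smoothX hp
  smoothU _ hp := h.smoothU hp
  Tx _ hp := (h.pd_T_eq_zero hp).1
  Tu _ hp := (h.pd_T_eq_zero hp).2
  Xu _ hp := h.Xu_eq_zero hp
  Xx _ hp := h.Xx_ne hp
  Uu _ hp := h.Uu_ne hp
  Uuu _ hp := h.Uuu_eq_zero hp
  Uux _ hp := h.Uux_eq_zero hp
  Uxx _ hp := h.Uxx_eq_zero hp
  Ut _ hp := h.Ut_eq hp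
  TU _ hp := h.U_relation hp
  TUu _ hp := h.Uu_eq hp

/-- The conditions concern only germs, so they can be glued from sets that need not be connected,
such as slices for different values of f. -/
theorem determining_of_local {Ω : Set Space} {T X U : Space → ℝ}
    (h : ∀ p ∈ Ω, ∃ Ω' : Set Space, p ∈ Ω' ∧ Determining Ω' T X U) : Determining Ω T X U := by
  choose! V hV hd using h
  constructor <;> intro p hp
  · exact (hd p hp).smoothT p (hV p hp)
  · exact (hd p hp).smoothX p (hV p hp)
  · exact (hd p hp).smoothU p (hV p hp)
  · exact (hd p hp).Tx p (hV p hp)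
  · exact (hd p hp).Tu p (hV p hp)
  · exact (hd p hp).Xu p (hV p hp)
  · exact (hd p hp).Xx p (hV p hp)
  · exact (hd p hp).Uu p (hV p hp)
  · exact (hd p hp).Uuu p (hV p hp)
  · exact (hd p hp).Uux p (hV p hp)
  · exact (hd p hp).Uxx p (hV p hp)
  · exact (hd p hp).Ut p (hV p hp)
  · exact (hd p hp).TU p (hV p hp)
  · exact (hd p hp).TUu p (hV p hp)

theorem exists_const {Ω : Set Space} (hΩ : IsOpen Ω) (hc : IsConnected Ω) {F : Space → ℝ}
    (hF : ∀ p ∈ Ω, DifferentiableAt ℝ F p)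
    (h : ∀ p ∈ Ω, pd et F p = 0 ∧ pd ex F p = 0 ∧ pd eu F p = 0) : ∃ c : ℝ, ∀ p ∈ Ω, F p = c := by
  obtain ⟨p₀, hp₀⟩ := hc.nonempty
  refine ⟨F p₀, fun p hp => ?_⟩
  refine hΩ.is_const_of_fderiv_eq_zero hc.isPreconnected
    (fun y hy => (hF y hy).differentiableWithinAt) (fun y hy => ?_) hp hp₀
  refine ContinuousLinearMap.ext fun ξ => ?_
  obtain ⟨h1, h2, h3⟩ := h y hy
  obtain ⟨⟨a, b⟩, c⟩ := ξ
  change pd ((a, b), c) F y = 0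
  rw [pd_comb, h1, h2, h3]; ring

/-- Every constant is found as a first integral: an expression with zero gradient on the connected
set Ω. This avoids integrating over sections of Ω, which may be disconnected. The last identity
records X_x^2 / T_t, the multiplier of f. -/
theorem Determining.exists_params {Ω : Set Space} {T X U : Space → ℝ} (h : Determining Ω T X U)
    (hΩ : IsOpen Ω) (hc : IsConnected Ω) :
    ∃ c : Params, c.Nondegenerate ∧ ∀ p ∈ Ω, c.γ * p.1.1 + c.δ ≠ 0 ∧
      T p = (c.α * p.1.1 + c.β) / (c.γ * p.1.1 + c.δ) ∧
      X p = (c.κ * p.1.2 + c.μ₁ * p.1.1 + c.μ₀) / (c.γ * p.1.1 + c.δ) ∧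
      U p = (c.κ * (c.γ * p.1.1 + c.δ) * p.2 - c.κ * c.γ * p.1.2 + c.μ₁ * c.δ - c.μ₀ * c.γ)
        / c.disc ∧
      pd et T p * c.κ ^ 2 / c.disc = pd ex X p ^ 2 := by
  have dT := fun p hp => differentiableAt_of_smooth (h.smoothT p hp)
  have dX := fun p hp => differentiableAt_of_smooth (h.smoothX p hp)
  have dU := fun p hp => differentiableAt_of_smooth (h.smoothU p hp)
  have dUx := fun p hp => differentiableAt_of_smooth (contDiffAt_pd (h.smoothU p hp) ex)
  have dUu := fun p hp => differentiableAt_of_smooth (contDiffAt_pd (h.smoothU p hp) eu)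
  have dTt := fun p hp => differentiableAt_of_smooth (contDiffAt_pd (h.smoothT p hp) et)
  have ct : ∀ p : Space, DifferentiableAt ℝ (fun y : Space => y.1.1) p := fun p => by fun_prop
  have cx : ∀ p : Space, DifferentiableAt ℝ (fun y : Space => y.1.2) p := fun p => by fun_prop
  have cu : ∀ p : Space, DifferentiableAt ℝ (fun y : Space => y.2) p := fun p => by fun_prop
  -- The x- and u-derivatives of U_t + u U_x = 0 give U_tx = 0 and U_tu = -U_x. Hence U_x = m and
  -- U_u = L := -m t + l, so that γ = -m and δ = l.
  have Utx : ∀ p ∈ Ω, pd et (pd ex U) p = 0 := by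
    intro p hp
    have e := pd_eq_zero hΩ h.Ut ex hp
    have dUt := differentiableAt_of_smooth (contDiffAt_pd (h.smoothU p hp) et)
    have d1 := dUx p hp
    rw [pd_add _ dUt (by fun_prop), pd_mul _ (cu p) d1, h.Uxx p hp, pd_coord_u,
      pd_comm (h.smoothU p hp) ex et] at e
    simp only [ex] at e ⊢
    linear_combination e
  obtain ⟨m, hm⟩ := exists_const hΩ hc dUx fun p hp =>
    ⟨Utx p hp, h.Uxx p hp, (pd_comm (h.smoothU p hp) eu ex).trans (h.Uux p hp)⟩
  have Uut : ∀ p ∈ Ω, pd et (pd eu U) p = -m := by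
    intro p hp
    have e := pd_eq_zero hΩ h.Ut eu hp
    have dUt := differentiableAt_of_smooth (contDiffAt_pd (h.smoothU p hp) et)
    have d1 := dUx p hp
    rw [pd_add _ dUt (by fun_prop), pd_mul _ (cu p) d1, pd_comm (h.smoothU p hp) eu ex,
      h.Uux p hp, pd_coord_u, pd_comm (h.smoothU p hp) eu et, hm p hp] at e
    simp only [eu] at e ⊢
    linear_combination e
  obtain ⟨l, hl⟩ := exists_const hΩ hc (F := fun y => pd eu U y + m * y.1.1)
    (fun p hp => (dUu p hp).add ((ct p).const_mul m)) fun p hp => by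
      have d1 := dUu p hp
      refine ⟨?_, ?_, ?_⟩ <;>
        rw [pd_add _ (by fun_prop) (by fun_prop), pd_mul _ (by fun_prop) (by fun_prop), pd_const,
          pd_coord_t]
      · rw [Uut p hp]; simp [et]
      · rw [h.Uux p hp]; simp [ex]
      · rw [h.Uuu p hp]; simp [eu]
  have hL : ∀ p ∈ Ω, pd eu U p = -m * p.1.1 + l := fun p hp => by linear_combination hl p hp
  have hLne : ∀ p ∈ Ω, -m * p.1.1 + l ≠ 0 := fun p hp => hL p hp ▸ h.Uu p hp
  have dL : ∀ p : Space, DifferentiableAt ℝ (fun y : Space => -m * y.1.1 + l) p := fun p => by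
    fun_prop
  have pdL : ∀ v p : Space, pd v (fun y : Space => -m * y.1.1 + l) p = -m * v.1.1 := by
    intro v p
    rw [pd_add _ (by fun_prop) (by fun_prop), pd_mul _ (by fun_prop) (by fun_prop), pd_const,
      pd_const, pd_coord_t]; ring
  obtain ⟨n, hn⟩ := exists_const hΩ hc
    (F := fun y => U y - ((-m * y.1.1 + l) * y.2 + m * y.1.2))
    (fun p hp => by have := dU p hp; fun_prop) fun p hp => by
      have d1 := dU p hp
      have e1 := h.Ut p hp
      have e2 := hm p hp
      have e3 := hL p hp
      refine ⟨?_, ?_, ?_⟩ <;>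
        rw [pd_sub _ (by fun_prop) (by fun_prop), pd_add _ (by fun_prop) (by fun_prop),
          pd_mul _ (dL p) (by fun_prop), pd_mul _ (by fun_prop) (by fun_prop),
          pd_const, pd_coord_u, pd_coord_x, pdL] <;>
        simp only [et, ex, eu] at e1 e2 e3 ⊢
      · linear_combination e1 - p.2 * e2
      · linear_combination e2
      · linear_combination e3
  have hU : ∀ p ∈ Ω, U p = (-m * p.1.1 + l) * p.2 + m * p.1.2 + n := fun p hp => by
    linear_combination hn p hp
  have Ttx : ∀ p ∈ Ω, pd ex (pd et T) p = 0 := fun p hp =>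
    (pd_comm (h.smoothT p hp) ex et).trans (pd_eq_zero hΩ h.Tx et hp)
  have Ttu : ∀ p ∈ Ω, pd eu (pd et T) p = 0 := fun p hp =>
    (pd_comm (h.smoothT p hp) eu et).trans (pd_eq_zero hΩ h.Tu et hp)
  have hXt : ∀ p ∈ Ω, pd et X p = pd et T p * (m * p.1.2 + n) := by
    intro p hp
    linear_combination -h.TU p hp + p.2 * h.TUu p hp + pd et T p * hU p hp
      - p.2 * pd et T p * hL p hp
  -- Compatibility of X_t = T_t (m x + n) with X_x = T_t L; it makes L^2 T_t constant.
  have Ttt : ∀ p ∈ Ω, pd et (pd et T) p * (-m * p.1.1 + l) = 2 * m * pd et T p := by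
    intro p hp
    have d1 := dTt p hp
    have e1 := pd_congr hΩ hXt ex hp
    have e2 := pd_congr hΩ h.TUu et hp
    rw [pd_mul _ d1 (by fun_prop), pd_add _ (by fun_prop) (by fun_prop), pd_mul _ (by fun_prop)
      (by fun_prop), pd_const, pd_const, pd_coord_x, Ttx p hp] at e1
    rw [pd_mul _ d1 (dUu p hp), Uut p hp, hL p hp, pd_comm (h.smoothX p hp) et ex] at e2
    simp only [et, ex] at e1 e2 ⊢
    linear_combination e2 + e1
  obtain ⟨k, hk⟩ := exists_const hΩ hc
    (F := fun y => (-m * y.1.1 + l) * ((-m * y.1.1 + l) * pd et T y))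
    (fun p hp => by have := dTt p hp; fun_prop) fun p hp => by
      have d1 := dTt p hp
      have e := Ttt p hp
      refine ⟨?_, ?_, ?_⟩ <;> rw [pd_mul _ (dL p) (by fun_prop), pd_mul _ (dL p) d1, pdL]
      · simp only [et] at e ⊢
        linear_combination (-m * p.1.1 + l) * e
      · rw [Ttx p hp]; simp [ex]
      · rw [Ttu p hp]; simp [eu]
  have hXx : ∀ p ∈ Ω, (-m * p.1.1 + l) * pd ex X p = k := fun p hp => by
    linear_combination hk p hp - (-m * p.1.1 + l) * h.TUu p hp
      + (-m * p.1.1 + l) * pd et T p * hL p hp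
  -- The integrals are read off from the expected answer: L T = α t + β gives α as the t-derivative
  -- of L T. Likewise L X = k x + μ₁ t + μ₀ gives μ₁ as the t-derivative of L X.
  obtain ⟨α, hα⟩ := exists_const hΩ hc
    (F := fun y => (-m * y.1.1 + l) * pd et T y - m * T y)
    (fun p hp => by have := dTt p hp; have := dT p hp; fun_prop) fun p hp => by
      have d1 := dTt p hp
      have d2 := dT p hp
      have e := Ttt p hp
      refine ⟨?_, ?_, ?_⟩ <;>
        rw [pd_sub _ (by fun_prop) (by fun_prop), pd_mul _ (dL p) d1, pd_mul _ (by fun_prop) d2,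
          pd_const, pdL]
      · simp only [et] at e ⊢
        linear_combination e
      · rw [Ttx p hp, h.Tx p hp]; simp [ex]
      · rw [Ttu p hp, h.Tu p hp]; simp [eu]
  obtain ⟨β, hβ⟩ := exists_const hΩ hc
    (F := fun y => (-m * y.1.1 + l) * T y - α * y.1.1)
    (fun p hp => by have := dT p hp; fun_prop) fun p hp => by
      have d2 := dT p hp
      have e := hα p hp
      refine ⟨?_, ?_, ?_⟩ <;>
        rw [pd_sub _ (by fun_prop) (by fun_prop), pd_mul _ (dL p) d2,
          pd_mul _ (by fun_prop) (by fun_prop), pd_const, pdL, pd_coord_t]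
      · simp only [et] at e ⊢
        linear_combination e
      · rw [h.Tx p hp]; simp [ex]
      · rw [h.Tu p hp]; simp [eu]
  obtain ⟨μ₁, hμ₁⟩ := exists_const hΩ hc
    (F := fun y => (-m * y.1.1 + l) * pd et T y * (m * y.1.2 + n) - m * X y)
    (fun p hp => by have := dTt p hp; have := dX p hp; fun_prop) fun p hp => by
      have d1 := dTt p hp
      have d2 := dX p hp
      have d3 : DifferentiableAt ℝ (fun y : Space => m * y.1.2 + n) p := by fun_prop
      have e := Ttt p hp
      have e1 := hXt p hp
      have e2 := hXx p hp
      have e3 := hk p hp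
      refine ⟨?_, ?_, ?_⟩ <;>
        rw [pd_sub _ (by fun_prop) (by fun_prop), pd_mul _ (by fun_prop) d3, pd_mul _ (dL p) d1,
          pd_mul _ (by fun_prop) d2, pdL, pd_add _ (by fun_prop) (by fun_prop),
          pd_mul _ (by fun_prop) (by fun_prop), pd_const, pd_const, pd_coord_x]
      · rw [e1]
        simp only [et] at e ⊢
        linear_combination (m * p.1.2 + n) * e
      · rw [Ttx p hp]
        refine (mul_eq_zero.1 ?_).resolve_left (hLne p hp)
        simp only [ex, et] at e2 e3 ⊢
        linear_combination m * e3 - m * e2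
      · rw [Ttu p hp, h.Xu p hp]; simp [eu]
  obtain ⟨μ₀, hμ₀⟩ := exists_const hΩ hc
    (F := fun y => (-m * y.1.1 + l) * X y - k * y.1.2 - μ₁ * y.1.1)
    (fun p hp => by have := dX p hp; fun_prop) fun p hp => by
      have d2 := dX p hp
      have e := hμ₁ p hp
      have e1 := hXt p hp
      have e2 := hXx p hp
      refine ⟨?_, ?_, ?_⟩ <;>
        rw [pd_sub _ (by fun_prop) (by fun_prop), pd_sub _ (by fun_prop) (by fun_prop),
          pd_mul _ (dL p) d2, pd_mul _ (by fun_prop) (by fun_prop),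
          pd_mul _ (by fun_prop) (by fun_prop), pd_const, pd_const, pdL, pd_coord_t, pd_coord_x]
      · rw [e1]
        simp only [et] at e ⊢
        linear_combination e
      · simp only [ex] at e2 ⊢
        linear_combination e2
      · rw [h.Xu p hp]; simp [eu]
  obtain ⟨p₀, hp₀⟩ := hc.nonempty
  have hkne : k ≠ 0 := by
    rw [← hXx p₀ hp₀]
    exact mul_ne_zero (hLne p₀ hp₀) (h.Xx p₀ hp₀)
  -- This construction fixes the common multiplier of the constants by the normalization κ = αδ -
  -- βγ.
  have hdisc : α * l - β * -m = k := by
    linear_combination hk p₀ hp₀ - (-m * p₀.1.1 + l) * hα p₀ hp₀ - m * hβ p₀ hp₀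
  refine ⟨⟨α, β, -m, l, k, μ₀, μ₁⟩, ⟨by rw [Params.disc, hdisc]; exact hkne, hkne⟩, fun p hp => ?_⟩
  have hL0 := hLne p hp
  simp only [Params.disc, hdisc]
  refine ⟨hL0, ?_, ?_, ?_, ?_⟩
  · rw [eq_div_iff hL0]; linear_combination hβ p hp
  · rw [eq_div_iff hL0]; linear_combination hμ₀ p hp
  · rw [eq_div_iff hkne]
    linear_combination k * hU p hp - (m * p.1.2 + n) * hk p hp
      + (-m * p.1.1 + l) * hμ₁ p hp + m * hμ₀ p hp
  · rw [div_eq_iff hkne]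
    refine mul_left_cancel₀ (pow_ne_zero 2 hL0) ?_
    linear_combination k ^ 2 * hk p hp
      - k * ((-m * p.1.1 + l) * pd ex X p + k) * hXx p hp

/-! ### The linear-fractional transformations preserve the class -/

namespace Params

/-- The action of the transformation with constants `c` on the space of `(t, x)`. -/
noncomputable def plane (c : Params) (z : Plane) : Plane :=
  ((c.α * z.1 + c.β) / (c.γ * z.1 + c.δ),
    (c.κ * z.2 + c.μ₁ * z.1 + c.μ₀) / (c.γ * z.1 + c.δ))

/-- The transformation of the extended space with constants `c`. -/
noncomputable def extMap (c : Params) (q : ExtSpace) : ExtSpace :=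
  ((c.plane q.1.1, (c.κ * (c.γ * q.1.1.1 + c.δ) * q.1.2 - c.κ * c.γ * q.1.1.2
    + c.μ₁ * c.δ - c.μ₀ * c.γ) / c.disc), c.κ ^ 2 / c.disc * q.2)

/-- The inverse of `Params.plane`. -/
noncomputable def planeInv (c : Params) (z : Plane) : Plane :=
  ((c.δ * z.1 - c.β) / (c.α - c.γ * z.1),
    (z.2 * (c.disc / (c.α - c.γ * z.1)) - c.μ₁ * ((c.δ * z.1 - c.β) / (c.α - c.γ * z.1)) - c.μ₀)
      / c.κ)

/-- The inverse of `Params.extMap`. -/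
noncomputable def extInv (c : Params) (q : ExtSpace) : ExtSpace :=
  ((c.planeInv q.1.1, (c.disc * q.1.2 + c.κ * c.γ * (c.planeInv q.1.1).2 - c.μ₁ * c.δ
    + c.μ₀ * c.γ) * (c.α - c.γ * q.1.1.1) / (c.κ * c.disc)), c.disc / c.κ ^ 2 * q.2)

theorem plane_denominator (c : Params) {z : Plane} (hz : c.γ * z.1 + c.δ ≠ 0) :
    c.α - c.γ * (c.plane z).1 = c.disc / (c.γ * z.1 + c.δ) := by
  simp only [plane, disc]; field_simp; ring

theorem plane_denominator_ne (c : Params) (hc : c.Nondegenerate) {z : Plane}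
    (hz : c.γ * z.1 + c.δ ≠ 0) : c.α - c.γ * (c.plane z).1 ≠ 0 := by
  rw [c.plane_denominator hz]; exact div_ne_zero hc.1 hz

theorem planeInv_plane (c : Params) (hc : c.Nondegenerate) {z : Plane}
    (hz : c.γ * z.1 + c.δ ≠ 0) : c.planeInv (c.plane z) = z := by
  have hd := hc.1
  have hk := hc.2
  have e1 : (c.δ * (c.plane z).1 - c.β) / (c.α - c.γ * (c.plane z).1) = z.1 := by
    rw [div_eq_iff (c.plane_denominator_ne hc hz), c.plane_denominator hz, plane]
    obtain ⟨L, hL⟩ : ∃ L, L = c.γ * z.1 + c.δ := ⟨_, rfl⟩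
    rw [← hL] at hz ⊢
    field_simp
    rw [hL, disc]; ring
  have e2 : c.disc / (c.α - c.γ * (c.plane z).1) = c.γ * z.1 + c.δ := by
    rw [c.plane_denominator hz]; field_simp
  rw [planeInv, e1, e2]
  refine Prod.ext rfl ?_
  obtain ⟨L, hL⟩ : ∃ L, L = c.γ * z.1 + c.δ := ⟨_, rfl⟩
  simp only [plane, ← hL] at hz ⊢
  field_simp; ring

theorem extInv_extMap (c : Params) (hc : c.Nondegenerate) {q : ExtSpace}
    (hq : c.γ * q.1.1.1 + c.δ ≠ 0) : c.extInv (c.extMap q) = q := by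
  have hd := hc.1
  have hk := hc.2
  have e := c.planeInv_plane hc hq
  have e2 := c.plane_denominator hq
  obtain ⟨⟨z, u⟩, w⟩ := q
  simp only [extInv, extMap] at *
  rw [e, e2]
  refine Prod.ext (Prod.ext rfl ?_) ?_
  · field_simp; ring
  · field_simp

theorem contDiffAt_extMap (c : Params) {q : ExtSpace} (hq : c.γ * q.1.1.1 + c.δ ≠ 0) :
    ContDiffAt ℝ ∞ c.extMap q := by
  unfold extMap plane
  refine ContDiffAt.prodMk (ContDiffAt.prodMk (ContDiffAt.prodMk ?_ ?_) ?_) ?_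
  · exact ContDiffAt.div (by fun_prop) (by fun_prop) hq
  · exact ContDiffAt.div (by fun_prop) (by fun_prop) hq
  · fun_prop
  · fun_prop

theorem contDiffAt_planeInv (c : Params) {z : Plane} (hz : c.α - c.γ * z.1 ≠ 0) :
    ContDiffAt ℝ ∞ c.planeInv z := by
  have h1 : ContDiffAt ℝ ∞ (fun z : Plane => (c.δ * z.1 - c.β) / (c.α - c.γ * z.1)) z :=
    ContDiffAt.div (by fun_prop) (by fun_prop) hz
  have h2 : ContDiffAt ℝ ∞ (fun z : Plane => c.disc / (c.α - c.γ * z.1)) z :=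
    ContDiffAt.div (by fun_prop) (by fun_prop) hz
  unfold planeInv
  exact h1.prodMk ((((contDiffAt_snd.mul h2).sub (contDiffAt_const.mul h1)).sub
    contDiffAt_const).div_const _)

theorem differentiableAt_extInv (c : Params) {q : ExtSpace} (hq : c.α - c.γ * q.1.1.1 ≠ 0) :
    DifferentiableAt ℝ c.extInv q := by
  have h1 : DifferentiableAt ℝ (fun q : ExtSpace => c.planeInv q.1.1) q :=
    (differentiableAt_of_smooth (c.contDiffAt_planeInv hq)).comp q
      (differentiableAt_fst.comp q differentiableAt_fst)
  unfold extInv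
  fun_prop

/-- The explicit local inverse and the chain rule make the determinant a factor of 1, so no Jacobian
has to be computed. -/
theorem det_fderiv_extMap_ne_zero (c : Params) (hc : c.Nondegenerate) {q : ExtSpace}
    (hq : c.γ * q.1.1.1 + c.δ ≠ 0) : (fderiv ℝ c.extMap q).det ≠ 0 := by
  have h1 := (differentiableAt_of_smooth (c.contDiffAt_extMap hq)).hasFDerivAt
  have h2 : HasFDerivAt c.extInv _ (c.extMap q) :=
    (c.differentiableAt_extInv (q := c.extMap q) (c.plane_denominator_ne hc hq)).hasFDerivAt
  have h3 := h2.comp q h1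
  have hopen : ∀ᶠ y : ExtSpace in 𝓝 q, c.γ * y.1.1.1 + c.δ ≠ 0 := by
    have : ContinuousAt (fun y : ExtSpace => c.γ * y.1.1.1 + c.δ) q := by fun_prop
    exact this.eventually_ne hq
  have h4 : HasFDerivAt (c.extInv ∘ c.extMap) (ContinuousLinearMap.id ℝ ExtSpace) q :=
    (hasFDerivAt_id q).congr_of_eventuallyEq (by
      filter_upwards [hopen] with y hy using c.extInv_extMap hc hy)
  have h5 := congrArg (fun A : ExtSpace →L[ℝ] ExtSpace => LinearMap.det A.toLinearMap)
    (h3.unique h4)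
  exact right_ne_zero_of_mul_eq_one
    ((LinearMap.det_comp _ _).symm.trans (h5.trans LinearMap.det_id))

/-- The image of an arbitrary element under the transformation with constants `c`. -/
noncomputable def image (c : Params) (hc : c.Nondegenerate) (f : ArbitraryElement) :
    ArbitraryElement where
  domain := {z | c.α - c.γ * z.1 ≠ 0} ∩ c.planeInv ⁻¹' f.domain
  isOpen_domain := by
    refine ContinuousOn.isOpen_inter_preimage (fun z hz =>
      (c.contDiffAt_planeInv hz).continuousAt.continuousWithinAt) ?_ f.isOpen_domain
    exact isOpen_ne_fun (by fun_prop) (by fun_prop)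
  toFun z := c.κ ^ 2 / c.disc * f.toFun (c.planeInv z)
  smooth := by
    intro z hz
    have h1 : ContDiffAt ℝ ∞ f.toFun (c.planeInv z) :=
      f.smooth.contDiffAt (f.isOpen_domain.mem_nhds hz.2)
    exact (contDiffAt_const.mul (h1.comp z (c.contDiffAt_planeInv hz.1))).contDiffWithinAt
  ne_zero z hz := mul_ne_zero (div_ne_zero (pow_ne_zero 2 hc.2) hc.1) (f.ne_zero _ hz.2)

end Params

theorem isOpen_slice {O : Set ExtSpace} (hO : IsOpen O) (f : ArbitraryElement) :
    IsOpen (slice O f) := by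
  have h1 : IsOpen {p : Space | p.1 ∈ f.domain} := f.isOpen_domain.preimage continuous_fst
  have h2 : ContinuousOn (fun p : Space => ((p, f.toFun p.1) : ExtSpace)) {p | p.1 ∈ f.domain} :=
    continuousOn_id.prodMk (f.smooth.continuousOn.comp continuousOn_fst fun _ hp => hp)
  exact h2.isOpen_inter_preimage h1 hO

/-- With L = γt + δ, the new left-hand side equals κ L^3 / (αδ - βγ)^2 times the old one. The terms
with γ, μ₀, μ₁ in v_T cancel against those in v v_X. -/
theorem transforms_lhs {c : Params} (hc : c.Nondegenerate) {f g u v : Plane → ℝ} {z : Plane}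
    (hz : c.γ * z.1 + c.δ ≠ 0) (hu : ContDiffAt ℝ ∞ u z) (hv : ContDiffAt ℝ ∞ v (c.plane z))
    (h : ∀ᶠ y in 𝓝 z, v (c.plane y) = (c.κ * (c.γ * y.1 + c.δ) * u y - c.κ * c.γ * y.2
      + c.μ₁ * c.δ - c.μ₀ * c.γ) / c.disc)
    (hg : g (c.plane z) = c.κ ^ 2 / c.disc * f z) (h0 : lhs f u z = 0) :
    lhs g v (c.plane z) = 0 := by
  have hd := hc.1
  have hk := hc.2
  rw [lhs_eq hu] at h0
  rw [lhs_eq hv, h.self_of_nhds, hg]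
  have hlt : HasDerivAt (fun s : ℝ => (z.1 + s, z.2)) (1, 0) 0 :=
    ((hasDerivAt_id (0 : ℝ)).const_add z.1).prodMk (hasDerivAt_const 0 z.2)
  have hlx : ∀ s, HasDerivAt (fun s : ℝ => (z.1, z.2 + s)) (0, 1) s := fun s =>
    (hasDerivAt_const s z.1).prodMk ((hasDerivAt_id s).const_add z.2)
  have hlt0 : (fun s : ℝ => (z.1 + s, z.2)) 0 = z := by simp
  have hlx0 : (fun s : ℝ => (z.1, z.2 + s)) 0 = z := by simp
  have htt : Filter.Tendsto (fun s : ℝ => (z.1 + s, z.2)) (𝓝 0) (𝓝 z) := by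
    simpa only [add_zero] using hlt.continuousAt.tendsto
  have htx : Filter.Tendsto (fun s : ℝ => (z.1, z.2 + s)) (𝓝 0) (𝓝 z) := by
    simpa only [add_zero] using (hlx 0).continuousAt.tendsto
  have hchain : ∀ {w : Plane → ℝ} (l : ℝ → Plane) {l' : Plane} {s : ℝ},
      DifferentiableAt ℝ w (l s) → HasDerivAt l l' s →
      HasDerivAt (fun s => w (l s)) (fderiv ℝ w (l s) l') s := fun _ _ _ hw hl =>
    hw.hasFDerivAt.comp_hasDerivAt _ hl
  -- first and second derivatives in the direction of `x`
  have hQ : ∀ s : ℝ, HasDerivAt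
      (fun s => (c.κ * (z.2 + s) + c.μ₁ * z.1 + c.μ₀) / (c.γ * z.1 + c.δ))
      (c.κ / (c.γ * z.1 + c.δ)) s := by
    intro s
    have := ((((((hasDerivAt_id s).const_add z.2).const_mul c.κ).add_const
      (c.μ₁ * z.1)).add_const c.μ₀).div_const (c.γ * z.1 + c.δ))
    simpa using this
  have hRx : ∀ᶠ s in 𝓝 (0 : ℝ), HasDerivAt
      (fun s => (c.κ * (c.γ * z.1 + c.δ) * u (z.1, z.2 + s) - c.κ * c.γ * (z.2 + s)
        + c.μ₁ * c.δ - c.μ₀ * c.γ) / c.disc)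
      ((c.κ * (c.γ * z.1 + c.δ) * fderiv ℝ u (z.1, z.2 + s) (0, 1) - c.κ * c.γ) / c.disc) s := by
    filter_upwards [htx.eventually (eventually_differentiableAt hu)] with s hs
    have h1 := (hchain (fun s => (z.1, z.2 + s)) hs (hlx s)).const_mul (c.κ * (c.γ * z.1 + c.δ))
    have h2 := ((hasDerivAt_id s).const_add z.2).const_mul (c.κ * c.γ)
    have := (((h1.sub h2).add_const (c.μ₁ * c.δ)).sub_const (c.μ₀ * c.γ)).div_const c.disc
    simpa using this
  have hRxx : HasDerivAt (fun s =>
      (c.κ * (c.γ * z.1 + c.δ) * fderiv ℝ u (z.1, z.2 + s) (0, 1) - c.κ * c.γ) / c.disc)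
      (c.κ * (c.γ * z.1 + c.δ) * fderiv ℝ (fun y => fderiv ℝ u y (0, 1)) z (0, 1) / c.disc) 0 := by
    have h1 : DifferentiableAt ℝ (fun y => fderiv ℝ u y (0, 1))
        ((fun s : ℝ => (z.1, z.2 + s)) 0) := by
      rw [hlx0]; exact differentiableAt_of_smooth (contDiffAt_fderiv_apply hu (0, 1))
    have h2 := (((hchain (fun s => (z.1, z.2 + s)) h1 (hlx 0)).const_mul (c.κ * (c.γ * z.1 + c.δ))).sub_const
      (c.κ * c.γ)).div_const c.disc
    refine h2.congr_deriv ?_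
    simp
  have hpz : ((c.α * z.1 + c.β) / (c.γ * z.1 + c.δ),
      (c.κ * (z.2 + 0) + c.μ₁ * z.1 + c.μ₀) / (c.γ * z.1 + c.δ)) = c.plane z := by
    simp [Params.plane]
  -- Along an x-line T is constant and X is affine, so `second_chain` yields v_X and v_XX directly.
  have hxd := second_chain (P := fun _ => (c.α * z.1 + c.β) / (c.γ * z.1 + c.δ)) (P' := fun _ => 0)
    (by rw [hpz]; exact hv)
    (Filter.Eventually.of_forall fun s => hasDerivAt_const s _) (hasDerivAt_const 0 _)
    (Filter.Eventually.of_forall hQ) (hasDerivAt_const 0 _) hRx hRxx (htx.eventually h)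
  simp only [hpz] at hxd
  simp only [zero_mul, zero_add, add_zero, forall_const] at hxd
  obtain ⟨ex1, ex2⟩ := hxd
  -- first derivative in the direction of `t`
  have hL : HasDerivAt (fun s : ℝ => c.γ * (z.1 + s) + c.δ) c.γ 0 := by
    simpa using (((hasDerivAt_id (0 : ℝ)).const_add z.1).const_mul c.γ).add_const c.δ
  have hPt : HasDerivAt (fun s : ℝ => (c.α * (z.1 + s) + c.β) / (c.γ * (z.1 + s) + c.δ))
      (c.disc / (c.γ * z.1 + c.δ) ^ 2) 0 := by
    have h1 : HasDerivAt (fun s : ℝ => c.α * (z.1 + s) + c.β) c.α 0 := by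
      simpa using (((hasDerivAt_id (0 : ℝ)).const_add z.1).const_mul c.α).add_const c.β
    refine (h1.div hL (by simpa using hz)).congr_deriv ?_
    simp only [add_zero, Params.disc]; ring
  have hQt : HasDerivAt
      (fun s : ℝ => (c.κ * z.2 + c.μ₁ * (z.1 + s) + c.μ₀) / (c.γ * (z.1 + s) + c.δ))
      ((c.μ₁ * (c.γ * z.1 + c.δ) - c.γ * (c.κ * z.2 + c.μ₁ * z.1 + c.μ₀))
        / (c.γ * z.1 + c.δ) ^ 2) 0 := by
    have h1 : HasDerivAt (fun s : ℝ => c.κ * z.2 + c.μ₁ * (z.1 + s) + c.μ₀) c.μ₁ 0 := by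
      simpa using ((((hasDerivAt_id (0 : ℝ)).const_add z.1).const_mul c.μ₁).const_add
        (c.κ * z.2)).add_const c.μ₀
    refine (h1.div hL (by simpa using hz)).congr_deriv ?_
    simp only [add_zero]; ring
  have hRt : HasDerivAt
      (fun s => (c.κ * (c.γ * (z.1 + s) + c.δ) * u (z.1 + s, z.2) - c.κ * c.γ * z.2
        + c.μ₁ * c.δ - c.μ₀ * c.γ) / c.disc)
      ((c.κ * c.γ * u z + c.κ * (c.γ * z.1 + c.δ) * fderiv ℝ u z (1, 0)) / c.disc) 0 := by
    have h1 : DifferentiableAt ℝ u ((fun s : ℝ => (z.1 + s, z.2)) 0) := by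
      rw [hlt0]; exact differentiableAt_of_smooth hu
    have h2 := ((((hL.const_mul c.κ).mul (hchain (fun s => (z.1 + s, z.2)) h1 hlt)).sub_const (c.κ * c.γ * z.2)).add_const
      (c.μ₁ * c.δ)).sub_const (c.μ₀ * c.γ)
    refine (h2.div_const c.disc).congr_deriv ?_
    simp
  have hpz' : ((c.α * (z.1 + 0) + c.β) / (c.γ * (z.1 + 0) + c.δ),
      (c.κ * z.2 + c.μ₁ * (z.1 + 0) + c.μ₀) / (c.γ * (z.1 + 0) + c.δ)) = c.plane z := by
    simp [Params.plane]
  have h6 := (hchain (fun s : ℝ => ((c.α * (z.1 + s) + c.β) / (c.γ * (z.1 + s) + c.δ),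
      (c.κ * z.2 + c.μ₁ * (z.1 + s) + c.μ₀) / (c.γ * (z.1 + s) + c.δ)))
      (by rw [hpz']; exact differentiableAt_of_smooth hv) (hPt.prodMk hQt)).unique
    (hRt.congr_of_eventuallyEq (htt.eventually h))
  have hcomb : ∀ a b : ℝ, fderiv ℝ v (c.plane z) (a, b)
      = a * fderiv ℝ v (c.plane z) (1, 0) + b * fderiv ℝ v (c.plane z) (0, 1) := by
    intro a b
    have : ((a, b) : Plane) = a • ((1, 0) : Plane) + b • ((0, 1) : Plane) := by simp
    rw [this, map_add, map_smul, map_smul, smul_eq_mul, smul_eq_mul]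
  rw [hpz', hcomb] at h6
  rw [Prod.mk.eta] at ex1
  have eX : fderiv ℝ v (c.plane z) (0, 1) = (c.γ * z.1 + c.δ) *
      ((c.γ * z.1 + c.δ) * fderiv ℝ u z (0, 1) - c.γ) / c.disc := by
    field_simp at ex1 ⊢
    linear_combination ex1
  have eXX : fderiv ℝ (fun y => fderiv ℝ v y (0, 1)) (c.plane z) (0, 1) = (c.γ * z.1 + c.δ) ^ 3 *
      fderiv ℝ (fun y => fderiv ℝ u y (0, 1)) z (0, 1) / (c.κ * c.disc) := by
    field_simp at ex2 ⊢
    linear_combination ex2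
  have eT : fderiv ℝ v (c.plane z) (1, 0) = ((c.γ * z.1 + c.δ) ^ 2 *
      (c.κ * c.γ * u z + c.κ * (c.γ * z.1 + c.δ) * fderiv ℝ u z (1, 0)) -
      (c.μ₁ * (c.γ * z.1 + c.δ) - c.γ * (c.κ * z.2 + c.μ₁ * z.1 + c.μ₀)) * c.disc *
      fderiv ℝ v (c.plane z) (0, 1)) / c.disc ^ 2 := by
    field_simp at h6 ⊢
    linear_combination h6
  rw [eT, eX, eXX]
  field_simp
  linear_combination c.κ * (c.γ * z.1 + c.δ) ^ 3 * h0

theorem isEquivalence_of_hasForm {O : Set ExtSpace} {φ : Space → Space} {Φ : ExtSpace → ℝ}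
    (hO : IsOpen O) (hconn : IsConnected O) {c : Params} (hc : c.Nondegenerate)
    (h : HasForm c O φ Φ) : IsEquivalence O φ Φ := by
  have hden : ∀ q ∈ O, c.γ * q.1.1.1 + c.δ ≠ 0 := fun ⟨⟨⟨t, x⟩, u⟩, w⟩ hq => (h t x u w hq).1
  have heq : ∀ q ∈ O, extend φ Φ q = c.extMap q := fun ⟨⟨⟨t, x⟩, u⟩, w⟩ hq => by
    simp only [extend, (h t x u w hq).2.1, (h t x u w hq).2.2]; rfl
  have hev : ∀ q ∈ O, extend φ Φ =ᶠ[𝓝 q] c.extMap := fun q hq =>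
    Filter.mem_of_superset (hO.mem_nhds hq) heq
  refine ⟨hO, hconn, fun q hq => ?_, fun q hq => ?_, fun f => ⟨c.image hc f, ?_, ?_⟩⟩
  · exact ((c.contDiffAt_extMap (hden q hq)).congr_of_eventuallyEq (hev q hq)).contDiffWithinAt
  · rw [(hev q hq).fderiv_eq]
    exact c.det_fderiv_extMap_ne_zero hc (hden q hq)
  · intro p hp
    have hd := hden _ hp.2
    have e := heq _ hp.2
    have e1 : (φ p).1 = c.plane p.1 := congrArg (fun q : ExtSpace => q.1.1) e
    have e2 : Φ (p, f.toFun p.1) = c.κ ^ 2 / c.disc * f.toFun p.1 :=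
      congrArg (fun q : ExtSpace => q.2) e
    have hinv := c.planeInv_plane hc (z := p.1) hd
    rw [e1, e2]
    refine ⟨⟨c.plane_denominator_ne hc hd, ?_⟩, ?_⟩
    · rw [Set.mem_preimage, hinv]; exact hp.1
    · simp only [Params.image, hinv]
  · intro p hp
    have hd := hden _ hp.2
    have e := heq _ hp.2
    have e1 : (φ p).1 = c.plane p.1 := congrArg (fun q : ExtSpace => q.1.1) e
    have hinv := c.planeInv_plane hc (z := p.1) hd
    rw [e1]
    refine ⟨hp.1, ⟨c.plane_denominator_ne hc hd, ?_⟩, fun u v hu hv hup htr h0 => ?_⟩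
    · rw [Set.mem_preimage, hinv]; exact hp.1
    · refine transforms_lhs hc hd hu hv ?_ (by simp only [Params.image, hinv]) h0
      -- The formulas hold only over O; by continuity the graph of u stays in the open slice near
      -- the point.
      have hcont : Filter.Tendsto (fun y => (y, u y)) (𝓝 p.1) (𝓝 p) := by
        have := (continuousAt_id.prodMk hu.continuousAt).tendsto
        simpa [hup] using this
      filter_upwards [htr, hcont.eventually ((isOpen_slice hO f).mem_nhds hp)] with y hy hs
      have e := heq _ hs.2
      have e1 : (φ (y, u y)).1 = c.plane y := congrArg (fun q : ExtSpace => q.1.1) e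
      rw [e1] at hy
      rw [hy]
      exact congrArg (fun q : ExtSpace => q.1.2) e

/-! ### Every equivalence transformation is linear-fractional -/

theorem surjective_of_det_ne_zero {E : Type*} [NormedAddCommGroup E] [NormedSpace ℝ E]
    [FiniteDimensional ℝ E] {A : E →L[ℝ] E} (h : A.det ≠ 0) : Function.Surjective A :=
  (LinearMap.equivOfDetNeZero A.toLinearMap h).surjective

theorem Setting.g_eq_of_params {Ω : Set Space} {φ : Space → Space} {f g : ArbitraryElement}
    {T X U : Space → ℝ} (h : Setting Ω φ f g T X U) {p : Space} (hp : p ∈ Ω) {k : ℝ}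
    (hk : pd et T p * k = pd ex X p ^ 2) : g.toFun (φ p).1 = k * f.toFun p.1 := by
  refine mul_left_cancel₀ (h.Tt_ne hp) ?_
  linear_combination h.g_eq hp - f.toFun p.1 * hk

/-- The constant arbitrary elements. -/
def ArbitraryElement.const (w : ℝ) (hw : w ≠ 0) : ArbitraryElement where
  domain := Set.univ
  isOpen_domain := isOpen_univ
  toFun _ := w
  smooth := contDiffOn_const
  ne_zero _ _ := hw

/-- Each constant f = w ≠ 0 yields the determining equations on its slice of O. The slices cover the
connected projection of O, so a single tuple of constants serves everywhere. -/
theorem exists_hasForm_of_isEquivalence {O : Set ExtSpace} {φ : Space → Space} {Φ : ExtSpace → ℝ}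
    (h : IsEquivalence O φ Φ) : ∃ c : Params, c.Nondegenerate ∧ HasForm c O φ Φ := by
  obtain ⟨hO, hconn, hsm, hdet, hmap⟩ := h
  have hE : ∀ q ∈ O, ContDiffAt ℝ ∞ (extend φ Φ) q := fun q hq =>
    hsm.contDiffAt (hO.mem_nhds hq)
  have hφ : ∀ q ∈ O, ContDiffAt ℝ ∞ φ q.1 := by
    intro q hq
    have h1 : ContDiffAt ℝ ∞ (fun p : Space => ((p, q.2) : ExtSpace)) q.1 :=
      contDiffAt_id.prodMk contDiffAt_const
    exact (ContDiffAt.comp (g := extend φ Φ) q.1 (hE q hq) h1).fst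
  -- The components φ do not involve f, so surjectivity of the extended differential passes to the
  -- differential of φ.
  have hsurj : ∀ q ∈ O, Function.Surjective (fderiv ℝ φ q.1) := by
    intro q hq y
    obtain ⟨ξ, hξ⟩ := surjective_of_det_ne_zero (hdet q hq) (y, 0)
    refine ⟨ξ.1, ?_⟩
    have h1 : HasFDerivAt (fun q : ExtSpace => φ q.1) _ q :=
      (differentiableAt_of_smooth (hE q hq)).hasFDerivAt.fst
    have h2 : HasFDerivAt (fun q : ExtSpace => φ q.1) _ q :=
      (differentiableAt_of_smooth (hφ q hq)).hasFDerivAt.comp q hasFDerivAt_fst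
    have h3 := congrArg (fun A : ExtSpace →L[ℝ] Space => A ξ) (h2.unique h1)
    exact h3.trans (congrArg Prod.fst hξ)
  have hset : ∀ (w : ℝ) (hw : w ≠ 0), ∃ g : ArbitraryElement,
      TransformsElement O φ Φ (.const w hw) g ∧ Setting (slice O (.const w hw)) φ (.const w hw) g
        (fun p => (φ p).1.1) (fun p => (φ p).1.2) (fun p => (φ p).2) := by
    intro w hw
    obtain ⟨g, hg1, hg2⟩ := hmap (.const w hw)
    refine ⟨g, hg1, ?_, fun p hp => (hφ _ hp.2).contDiffWithinAt, fun p hp => hsurj _ hp.2, hg2,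
      rfl, rfl, rfl⟩
    have : Continuous fun p : Space => ((p, w) : ExtSpace) := by fun_prop
    exact (isOpen_univ.preimage continuous_fst).inter (hO.preimage this)
  have hnear : ∀ q ∈ O, ∀ᶠ w in 𝓝[≠] q.2, w ≠ q.2 ∧ (q.1, w) ∈ O := by
    intro q hq
    have h1 : Continuous fun w : ℝ => ((q.1, w) : ExtSpace) := by fun_prop
    filter_upwards [self_mem_nhdsWithin,
      mem_nhdsWithin_of_mem_nhds ((hO.preimage h1).mem_nhds (show (q.1, q.2) ∈ O from hq))]
      with w h2 h3 using ⟨h2, h3⟩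
  have hdtm : Determining (Prod.fst '' O) (fun p => (φ p).1.1) (fun p => (φ p).1.2)
      (fun p => (φ p).2) := by
    refine determining_of_local ?_
    rintro _ ⟨q, hq, rfl⟩
    -- A point of O with f = 0 lies on no slice of an arbitrary element, but O is open, so a nearby
    -- nonzero w has the same projection.
    obtain ⟨w, hw, hwO⟩ : ∃ w : ℝ, w ≠ 0 ∧ (q.1, w) ∈ O := by
      by_cases h0 : q.2 = 0
      · obtain ⟨w, hw⟩ := (hnear q hq).exists
        exact ⟨w, h0 ▸ hw.1, hw.2⟩
      · exact ⟨q.2, h0, hq⟩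
    obtain ⟨g, -, hS⟩ := hset w hw
    exact ⟨slice O (.const w hw), ⟨trivial, hwO⟩, hS.determining⟩
  obtain ⟨c, hc, hform⟩ := hdtm.exists_params (isOpenMap_fst _ hO)
    (hconn.image _ continuous_fst.continuousOn)
  refine ⟨c, hc, fun t x u w hq => ?_⟩
  obtain ⟨h1, h2, h3, h4, h5⟩ := hform _ ⟨_, hq, rfl⟩
  refine ⟨h1, Prod.ext (Prod.ext h2 h3) h4, ?_⟩
  have hne : ∀ w : ℝ, w ≠ 0 → (((t, x), u), w) ∈ O →
      Φ (((t, x), u), w) = c.κ ^ 2 / c.disc * w := by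
    intro w hw hq
    obtain ⟨g, hg, hS⟩ := hset w hw
    have hp : ((t, x), u) ∈ slice O (.const w hw) := ⟨trivial, hq⟩
    have e1 := (hg _ hp).2
    rw [hS.g_eq_of_params hp (k := c.κ ^ 2 / c.disc) (by rw [← h5]; ring)] at e1
    exact e1.symm
  -- The value at w = 0 is the limit of the values at nonzero w.
  by_cases hw : w = 0
  · subst hw
    have hcont : ContinuousAt (fun w : ℝ => Φ (((t, x), u), w)) 0 := by
      have h6 : ContinuousAt (fun q => (extend φ Φ q).2) (((t, x), u), (0 : ℝ)) :=
        (hE _ hq).continuousAt.snd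
      have h7 : ContinuousAt (fun w : ℝ => ((((t, x), u), w) : ExtSpace)) 0 := by fun_prop
      exact ContinuousAt.comp (g := fun q => (extend φ Φ q).2) h6 h7
    have hlim : Filter.Tendsto (fun w : ℝ => Φ (((t, x), u), w)) (𝓝[≠] 0)
        (𝓝 (c.κ ^ 2 / c.disc * 0)) := by
      have h8 : Filter.Tendsto (fun w : ℝ => c.κ ^ 2 / c.disc * w) (𝓝[≠] 0)
          (𝓝 (c.κ ^ 2 / c.disc * 0)) :=
        (Continuous.tendsto (by fun_prop) 0).mono_left nhdsWithin_le_nhds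
      refine h8.congr' ?_
      filter_upwards [hnear _ hq] with w hw
      exact (hne w hw.1 hw.2).symm
    exact tendsto_nhds_unique (hcont.tendsto.mono_left nhdsWithin_le_nhds) hlim
  · exact hne w hw hq

/-! ### Uniqueness of the constants up to a multiplier -/

theorem hasForm_scale {c : Params} {O : Set ExtSpace} {φ : Space → Space} {Φ : ExtSpace → ℝ}
    (hc : c.Nondegenerate) (h : HasForm c O φ Φ) {s : ℝ} (hs : s ≠ 0) :
    HasForm (c.scale s) O φ Φ := by
  intro t x u w hq
  obtain ⟨h1, h2, h3⟩ := h t x u w hq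
  have hd := hc.1
  have hdisc : (c.scale s).disc = s ^ 2 * c.disc := by simp only [Params.disc, Params.scale]; ring
  have hL : s * c.γ * t + s * c.δ = s * (c.γ * t + c.δ) := by ring
  have hL' : s * (c.γ * t + c.δ) ≠ 0 := mul_ne_zero hs h1
  rw [h2, h3, hdisc]
  simp only [Params.scale, hL]
  refine ⟨hL', Prod.ext (Prod.ext ?_ ?_) ?_, ?_⟩ <;> field_simp

theorem exists_scale_of_hasForm {c c' : Params} {O : Set ExtSpace} {φ : Space → Space}
    {Φ : ExtSpace → ℝ} (hO : IsOpen O) (hne : O.Nonempty) (hc : c.Nondegenerate)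
    (hc' : c'.Nondegenerate) (h : HasForm c O φ Φ) (h' : HasForm c' O φ Φ) :
    ∃ s : ℝ, s ≠ 0 ∧ c' = c.scale s := by
  obtain ⟨⟨⟨⟨t, x⟩, u⟩, w⟩, hq⟩ := hne
  obtain ⟨ε, hε, hball⟩ := Metric.isOpen_iff.1 hO _ hq
  have hmem : ∀ a b d : ℝ, |a| < ε → |b| < ε → |d| < ε →
      (((t + a, x + b), u + d), w) ∈ O := by
    intro a b d ha hb hd
    refine hball ?_
    simp [Prod.dist_eq, ha, hb, hd]
  have hd := hc.1
  have hk := hc.2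
  have hd' := hc'.1
  have hk' := hc'.2
  have h0 : |(0 : ℝ)| < ε := by simpa using hε
  set η := ε / 2 with hη
  have hη0 : η ≠ 0 := by positivity
  have h2 : |η| < ε := by rw [abs_of_pos (by positivity)]; linarith
  have eqT : ∀ a : ℝ, |a| < ε → (c.α * (t + a) + c.β) * (c'.γ * (t + a) + c'.δ) =
      (c'.α * (t + a) + c'.β) * (c.γ * (t + a) + c.δ) := by
    intro a ha
    obtain ⟨n1, e1, -⟩ := h _ _ _ _ (hmem a 0 0 ha h0 h0)
    obtain ⟨n2, e2, -⟩ := h' _ _ _ _ (hmem a 0 0 ha h0 h0)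
    have := congrArg (fun y : Space => y.1.1) (e1.symm.trans e2)
    exact (div_eq_div_iff n1 n2).1 this
  have eqX : ∀ a b : ℝ, |a| < ε → |b| < ε →
      (c.κ * (x + b) + c.μ₁ * (t + a) + c.μ₀) * (c'.γ * (t + a) + c'.δ) =
      (c'.κ * (x + b) + c'.μ₁ * (t + a) + c'.μ₀) * (c.γ * (t + a) + c.δ) := by
    intro a b ha hb
    obtain ⟨n1, e1, -⟩ := h _ _ _ _ (hmem a b 0 ha hb h0)
    obtain ⟨n2, e2, -⟩ := h' _ _ _ _ (hmem a b 0 ha hb h0)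
    have := congrArg (fun y : Space => y.1.2) (e1.symm.trans e2)
    exact (div_eq_div_iff n1 n2).1 this
  have hL : ∀ a : ℝ, |a| < ε → c.γ * (t + a) + c.δ ≠ 0 := fun a ha =>
    (h _ _ _ _ (hmem a 0 0 ha h0 h0)).1
  have eqU : ∀ a : ℝ, |a| < ε → c.κ * (c.γ * (t + a) + c.δ) * c'.disc =
      c'.κ * (c'.γ * (t + a) + c'.δ) * c.disc := by
    intro a ha
    have e : ∀ d : ℝ, |d| < ε →
        (c.κ * (c.γ * (t + a) + c.δ) * (u + d) - c.κ * c.γ * (x + 0) + c.μ₁ * c.δ - c.μ₀ * c.γ)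
          * c'.disc =
        (c'.κ * (c'.γ * (t + a) + c'.δ) * (u + d) - c'.κ * c'.γ * (x + 0) + c'.μ₁ * c'.δ
          - c'.μ₀ * c'.γ) * c.disc := by
      intro d hda
      have := congrArg (fun y : Space => y.2)
        ((h _ _ _ _ (hmem a 0 d ha h0 hda)).2.1.symm.trans (h' _ _ _ _ (hmem a 0 d ha h0 hda)).2.1)
      exact (div_eq_div_iff hd hd').1 this
    refine mul_right_cancel₀ hη0 ?_
    linear_combination e η h2 - e 0 h0
  -- The multiplier comes from the u-coefficient of the U-component: it forces the two denominators
  -- γt + δ to be proportional with this factor. Numerators of T and X then follow suit.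
  obtain ⟨s, hs⟩ : ∃ s, s = c.κ * c'.disc / (c'.κ * c.disc) := ⟨_, rfl⟩
  have hs0 : s ≠ 0 := by rw [hs]; exact div_ne_zero (mul_ne_zero hk hd') (mul_ne_zero hk' hd)
  have hs1 : s * (c'.κ * c.disc) = c.κ * c'.disc := by rw [hs]; field_simp
  have eqL : ∀ a : ℝ, |a| < ε → c'.γ * (t + a) + c'.δ = s * (c.γ * (t + a) + c.δ) := by
    intro a ha
    refine mul_left_cancel₀ (mul_ne_zero hk' hd) ?_
    linear_combination -eqU a ha - (c.γ * (t + a) + c.δ) * hs1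
  have eqT' : ∀ a : ℝ, |a| < ε → c'.α * (t + a) + c'.β = s * (c.α * (t + a) + c.β) := by
    intro a ha
    refine mul_left_cancel₀ (hL a ha) ?_
    linear_combination -eqT a ha + (c.α * (t + a) + c.β) * eqL a ha
  have hγ : c'.γ = s * c.γ := by
    refine mul_left_cancel₀ hη0 ?_
    linear_combination eqL η h2 - eqL 0 h0
  have hδ : c'.δ = s * c.δ := by linear_combination eqL 0 h0 - t * hγ
  have hα : c'.α = s * c.α := by
    refine mul_left_cancel₀ hη0 ?_
    linear_combination eqT' η h2 - eqT' 0 h0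
  have hβ : c'.β = s * c.β := by linear_combination eqT' 0 h0 - t * hα
  have hκ : c'.κ = s * c.κ := by
    -- The discriminant is quadratic in the constants, so the definition of s becomes linear in s
    -- and gives κ' = s κ.
    have e : c'.disc = s ^ 2 * c.disc := by rw [Params.disc, Params.disc, hα, hβ, hγ, hδ]; ring
    rw [e] at hs1
    refine mul_left_cancel₀ (mul_ne_zero hs0 hd) ?_
    linear_combination hs1
  have eqX' : ∀ a : ℝ, |a| < ε → c'.μ₁ * (t + a) + c'.μ₀ = s * (c.μ₁ * (t + a) + c.μ₀) := by
    intro a ha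
    refine mul_left_cancel₀ (hL a ha) ?_
    linear_combination -eqX a 0 ha h0 + (c.κ * (x + 0) + c.μ₁ * (t + a) + c.μ₀) * eqL a ha
      - x * (c.γ * (t + a) + c.δ) * hκ
  have hμ₁ : c'.μ₁ = s * c.μ₁ := by
    refine mul_left_cancel₀ hη0 ?_
    linear_combination eqX' η h2 - eqX' 0 h0
  have hμ₀ : c'.μ₀ = s * c.μ₀ := by linear_combination eqX' 0 h0 - t * hμ₁
  exact ⟨s, hs0, Params.ext hα hβ hγ hδ hκ hμ₀ hμ₁⟩

/-! ### Normalization and the theorem -/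

theorem isNormalized : IsNormalized := by
  intro Ω f φ g ⟨⟨hΩ, hconn, hsm, hdet⟩, hmap⟩
  have hS : Setting Ω φ f g (fun p => (φ p).1.1) (fun p => (φ p).1.2) (fun p => (φ p).2) :=
    ⟨hΩ, hsm, fun p hp => surjective_of_det_ne_zero (hdet p hp), hmap, rfl, rfl, rfl⟩
  obtain ⟨c, hc, hform⟩ := hS.determining.exists_params hΩ hconn
  -- The formulas for φ on Ω make sense for every value of f, so the full cylinder over Ω serves as
  -- the domain.
  refine ⟨Ω ×ˢ Set.univ, φ, fun q => c.κ ^ 2 / c.disc * q.2, ?_, ?_, fun _ _ => rfl, ?_, ?_⟩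
  · refine isEquivalence_of_hasForm (hΩ.prod isOpen_univ) (hconn.prod isConnected_univ) hc ?_
    intro t x u w hq
    obtain ⟨h1, h2, h3, h4, -⟩ := hform _ hq.1
    exact ⟨h1, Prod.ext (Prod.ext h2 h3) h4, rfl⟩
  · exact Set.fst_image_prod _ Set.univ_nonempty
  · exact fun p hp => ⟨(hmap p hp).1, hp, trivial⟩
  · intro p hp
    refine ⟨(hmap p hp.2.1).2.1, hS.g_eq_of_params hp.2.1 ?_⟩
    rw [← (hform p hp.2.1).2.2.2.2]; ring

end GBE

theorem theorem1 :
    GBE.IsNormalized ∧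
    (∀ (O : Set GBE.ExtSpace) (φ : GBE.Space → GBE.Space) (Φ : GBE.ExtSpace → ℝ),
      IsOpen O → IsConnected O →
        (GBE.IsEquivalence O φ Φ ↔
          ∃ c : GBE.Params, c.Nondegenerate ∧ GBE.HasForm c O φ Φ)) ∧
    (∀ (O : Set GBE.ExtSpace) (φ : GBE.Space → GBE.Space) (Φ : GBE.ExtSpace → ℝ)
      (c c' : GBE.Params), IsOpen O → O.Nonempty → c.Nondegenerate → c'.Nondegenerate →
        GBE.HasForm c O φ Φ →
          (GBE.HasForm c' O φ Φ ↔ ∃ s : ℝ, s ≠ 0 ∧ c' = GBE.Params.scale s c)) := by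
  refine ⟨GBE.isNormalized, fun O φ Φ hO hconn => ⟨GBE.exists_hasForm_of_isEquivalence, ?_⟩,
    fun O φ Φ c c' hO hne hc hc' h => ⟨GBE.exists_scale_of_hasForm hO hne hc hc' h, ?_⟩⟩
  · rintro ⟨c, hc, h⟩
    exact GBE.isEquivalence_of_hasForm hO hconn hc h
  · rintro ⟨s, hs, rfl⟩
    exact GBE.hasForm_scale hc h hs
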